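/- Let $d\ge 2$ and $\Gamma>0$. Consider the Rayleigh--B\'enard system at infinite Prandtl number in the layer $\mathbb{R}^{d-1}\times[0,1]$, with vertical coordinate $x_d$, Rayleigh number $\mathsf{Ra}$ and slip length $\mathsf{L_s}>0$: \[ \nabla p-\Delta u=\mathsf{Ra}\,T e_d,\qquad \nabla\cdot u=0,\qquad \partial_t T+u\cdot\nabla T=\Delta T , \] with the boundary conditions, for $1\le i\le d-1$, \[ \partial_d u_i=\tfrac1{\mathsf{L_s}}u_i,\quad u_d=0,\quad T=1\quad\text{on }\{x_d=0\},\qquad -\partial_d u_i=\tfrac1{\mathsf{L_s}}u_i,\quad u_d=0,\quad T=0\quad\text{on }\{x_d=1\}, \] where $u$, $p$ and $T$ are $\Gamma$-periodic in each of $x_1,\dots,x_{d-1}$. A global smooth solution is a triple $(u,p,T)$ that satisfies these equations and boundary conditions for all $t>0$, is smooth up to the walls for $t>0$, and whose temperature $T$ is continuous up to $t=0$. Its Nusselt number is \[ \mathsf{Nu}=\limsup_{\tau\to\infty}\frac1\tau\int_0^\tau\frac1{\Gamma^{d-1}}\int_{[0,\Gamma]^{d-1}\times[0,1]}\big(u_dT-\partial_dT\big)\,dx\,dt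 . \] Then there is a constant $C>0$, depending only on $d$ and $\Gamma$, such that for all $\mathsf{L_s}>0$, all $\mathsf{Ra}>1$ and every global smooth solution, \[ \mathsf{Nu}\le C\,\mathsf{Ra}^{5/12}. \] -/

import Mathlib

open scoped ContDiff Topology

namespace RayleighBenard

/-- Points of space-time `(t, x)` in dimension `d = n + 1`. The coordinates `x i.castSucc` with
`i : Fin n` are horizontal and the coordinate `x (Fin.last n)` is vertical. -/
abbrev SpaceTime (n : ℕ) : Type := ℝ × (Fin (n + 1) → ℝ)

/-- The layer `0 ≤ x_d ≤ 1`, walls included, at positive times. -/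
def layer (n : ℕ) : Set (SpaceTime n) :=
  {q | 0 < q.1 ∧ q.2 (Fin.last n) ∈ Set.Icc (0 : ℝ) 1}

/-- The layer at all times `t ≥ 0`, the initial time included. -/
def closedLayer (n : ℕ) : Set (SpaceTime n) :=
  {q | 0 ≤ q.1 ∧ q.2 (Fin.last n) ∈ Set.Icc (0 : ℝ) 1}

/-- The lower wall `x_d = 0` at positive times. -/
def lowerWall (n : ℕ) : Set (SpaceTime n) := {q | 0 < q.1 ∧ q.2 (Fin.last n) = 0}

/-- The upper wall `x_d = 1` at positive times. -/
def upperWall (n : ℕ) : Set (SpaceTime n) := {q | 0 < q.1 ∧ q.2 (Fin.last n) = 1}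

/-- The spatial partial derivative `∂_j f`; it is taken within the layer, hence is the one-sided
derivative in the vertical direction at the walls. -/
noncomputable def pderiv {n : ℕ} (j : Fin (n + 1)) (f : SpaceTime n → ℝ) : SpaceTime n → ℝ :=
  fun q => fderivWithin ℝ f (layer n) q (0, Pi.single j 1)

/-- The time derivative `∂_t f`. -/
noncomputable def tderiv {n : ℕ} (f : SpaceTime n → ℝ) : SpaceTime n → ℝ :=
  fun q => fderivWithin ℝ f (layer n) q (1, 0)

/-- The spatial Laplacian `Δ f = ∑_j ∂_j ∂_j f`. -/
noncomputable def laplacian {n : ℕ} (f : SpaceTime n → ℝ) : SpaceTime n → ℝ :=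
  fun q => ∑ j, pderiv j (pderiv j f) q

/-- `f` is `Γ`-periodic in each horizontal coordinate. -/
def HorizontallyPeriodic {n : ℕ} {E : Type*} (Γ : ℝ) (f : SpaceTime n → E) : Prop :=
  ∀ q ∈ layer n, ∀ i : Fin n, f (q.1, q.2 + Pi.single i.castSucc Γ) = f q

/-- `(u, p, T)` is a global smooth solution of the Rayleigh-Bénard system in dimension `d = n + 1`
at infinite Prandtl number, with Rayleigh number `Ra`, Navier-slip conditions of slip length `Ls`
and fixed temperatures at the walls, horizontally periodic with period `Γ`. The fields are smooth
up to the walls at positive times, and the temperature is continuous up to the initial time. -/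
structure IsSolution (n : ℕ) (Γ Ls Ra : ℝ) (u : SpaceTime n → Fin (n + 1) → ℝ)
    (p T : SpaceTime n → ℝ) : Prop where
  smooth_u : ContDiffOn ℝ ∞ u (layer n)
  smooth_p : ContDiffOn ℝ ∞ p (layer n)
  smooth_T : ContDiffOn ℝ ∞ T (layer n)
  continuous_T : ContinuousOn T (closedLayer n)
  periodic_u : HorizontallyPeriodic Γ u
  periodic_p : HorizontallyPeriodic Γ p
  periodic_T : HorizontallyPeriodic Γ T
  /-- `∇p - Δu = Ra T e_d` -/
  momentum : ∀ q ∈ layer n, ∀ j : Fin (n + 1),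
    pderiv j p q - laplacian (fun r => u r j) q = if j = Fin.last n then Ra * T q else 0
  /-- `∇ · u = 0` -/
  incompressible : ∀ q ∈ layer n, ∑ j, pderiv j (fun r => u r j) q = 0
  /-- `∂_t T + u · ∇T = ΔT` -/
  heat : ∀ q ∈ layer n, tderiv T q + ∑ j, u q j * pderiv j T q = laplacian T q
  slip_lower : ∀ q ∈ lowerWall n, ∀ i : Fin n,
    pderiv (Fin.last n) (fun r => u r i.castSucc) q = 1 / Ls * u q i.castSucc
  slip_upper : ∀ q ∈ upperWall n, ∀ i : Fin n,
    -pderiv (Fin.last n) (fun r => u r i.castSucc) q = 1 / Ls * u q i.castSucc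
  no_flux_lower : ∀ q ∈ lowerWall n, u q (Fin.last n) = 0
  no_flux_upper : ∀ q ∈ upperWall n, u q (Fin.last n) = 0
  hot_lower : ∀ q ∈ lowerWall n, T q = 1
  cold_upper : ∀ q ∈ upperWall n, T q = 0

/-- The periodicity cell `[0, Γ]^n × [0, 1]`. -/
def cell (n : ℕ) (Γ : ℝ) : Set (Fin (n + 1) → ℝ) :=
  Set.Icc 0 (fun i => if i = Fin.last n then 1 else Γ)

/-- The average of `φ` over the periodicity cell and over the times from `0` to `τ`. -/
noncomputable def finiteTimeAverage {n : ℕ} (Γ : ℝ) (φ : SpaceTime n → ℝ) (τ : ℝ) : ℝ :=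
  1 / τ * ∫ t in (0 : ℝ)..τ, 1 / Γ ^ n * ∫ x in cell n Γ, φ (t, x)

/-- The long-time, global-in-space average `⟨φ⟩`, an upper limit in the extended reals. -/
noncomputable def longTimeAverage {n : ℕ} (Γ : ℝ) (φ : SpaceTime n → ℝ) : EReal :=
  Filter.limsup (fun τ : ℝ => (finiteTimeAverage Γ φ τ : EReal)) Filter.atTop

/-- The Nusselt number `Nu = ⟨u_d T - ∂_d T⟩`. -/
noncomputable def nusselt {n : ℕ} (Γ : ℝ) (u : SpaceTime n → Fin (n + 1) → ℝ)
    (T : SpaceTime n → ℝ) : EReal :=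
  longTimeAverage Γ (fun q => u q (Fin.last n) * T q - pderiv (Fin.last n) T q)

end RayleighBenard

/-! ### Geometry of the layer and differentiability within it -/

namespace RayleighBenard

open MeasureTheory Set

variable {n : ℕ}

/-! The bound comes from a boundary layer of width `1 / N`, `N = m + 1`, at the lower wall,
expressed by the polynomial weight `d ^ m` with `d = 1 - x_d`. Testing the heat equation with `d ^ N
- d` shows that the total heat flux `Φ` equals the flux averaged against the density `N * d ^ m`, up
to a time derivative (`cellIntegral_tderiv_weight`). Testing with `T - d` shows that `Φ` equals `X =
∫ |∇T|²`, again up to a time derivative (`cellIntegral_tderiv_energy`).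

In the weighted flux, `w = u_d` has zero mean on slices, so `w * T` may be replaced by `w * (T -
1)`. Both factors vanish at the lower wall, and `hardy_lower` trades them for vertical derivatives.
The remaining `∫ d ^ (m + 2) (∂_d w)²` gains one more power of `1 / N` from `weighted_sq_le`, at the
price of `∂_d² w`.

The velocity is controlled by the Stokes system. Its energy inequality gives `E = ∫ |∇u|² ≤ Ra * Φ`.
Horizontal derivatives solve the same system, and incompressibility writes `∂_d² w` in terms of
them, so `∫ (∂_d² w)²` is at most a multiple of `Ra * (κ * X + κ⁻¹ * E)`. The slip terms have a
favourable sign and are dropped, whence the uniformity in `Ls`.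

Optimising, the velocity contributes a multiple of `N⁻³ * Ra ^ (5/4) * (X + Φ)`, which is absorbed
once `N` is a large multiple of `Ra ^ (5/12)`; what remains is of order `N`. The time derivatives
belong to a functional that is concave quadratic in `T`, hence bounded above without a maximum
principle, and they disappear in the long-time average. -/

theorem convex_layer : Convex ℝ (layer n) := by
  have h : layer n = (fun q : SpaceTime n => q.1) ⁻¹' Ioi 0 ∩
      (fun q : SpaceTime n => q.2 (Fin.last n)) ⁻¹' Icc 0 1 := rfl
  rw [h]
  refine ((convex_Ioi (0 : ℝ)).linear_preimage (LinearMap.fst ℝ ℝ (Fin (n + 1) → ℝ))).inter ?_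
  exact (convex_Icc (0 : ℝ) 1).linear_preimage
    ((LinearMap.proj (Fin.last n)).comp (LinearMap.snd ℝ ℝ (Fin (n + 1) → ℝ)))

/-- The open layer at positive times. -/
def openLayer (n : ℕ) : Set (SpaceTime n) :=
  {q | 0 < q.1 ∧ q.2 (Fin.last n) ∈ Ioo (0 : ℝ) 1}

theorem isOpen_openLayer : IsOpen (openLayer n) :=
  (isOpen_Ioi.preimage continuous_fst).inter
    (isOpen_Ioo.preimage ((continuous_apply (Fin.last n)).comp continuous_snd))

theorem openLayer_subset : openLayer n ⊆ layer n :=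
  fun _ hq => ⟨hq.1, Ioo_subset_Icc_self hq.2⟩

theorem openLayer_subset_interior : openLayer n ⊆ interior (layer n) :=
  interior_maximal openLayer_subset isOpen_openLayer

theorem interior_layer_nonempty : (interior (layer n)).Nonempty :=
  ⟨(1, fun _ => 1 / 2), openLayer_subset_interior ⟨one_pos, by norm_num, by norm_num⟩⟩

theorem uniqueDiffOn_layer : UniqueDiffOn ℝ (layer n) :=
  uniqueDiffOn_convex convex_layer interior_layer_nonempty

/-- Symmetry of second derivatives at wall points requires them to be limits of interior points. -/
theorem layer_subset_closure_interior : layer n ⊆ closure (interior (layer n)) := by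
  rw [convex_layer.closure_interior_eq_closure_of_nonempty_interior interior_layer_nonempty]
  exact subset_closure

theorem differentiableOn_of_smooth {f : SpaceTime n → ℝ} (hf : ContDiffOn ℝ ∞ f (layer n)) :
    DifferentiableOn ℝ f (layer n) := hf.differentiableOn (by simp)

theorem hasFDerivWithinAt_of_smooth {f : SpaceTime n → ℝ} (hf : ContDiffOn ℝ ∞ f (layer n))
    {q : SpaceTime n} (hq : q ∈ layer n) :
    HasFDerivWithinAt f (fderivWithin ℝ f (layer n) q) (layer n) q :=
  (differentiableOn_of_smooth hf q hq).hasFDerivWithinAt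

theorem contDiffOn_fderivWithin_layer {f : SpaceTime n → ℝ} (hf : ContDiffOn ℝ ∞ f (layer n)) :
    ContDiffOn ℝ ∞ (fderivWithin ℝ f (layer n)) (layer n) :=
  hf.fderivWithin uniqueDiffOn_layer (by simp)

@[fun_prop]
theorem contDiffOn_pderiv {f : SpaceTime n → ℝ} (j : Fin (n + 1))
    (hf : ContDiffOn ℝ ∞ f (layer n)) : ContDiffOn ℝ ∞ (pderiv j f) (layer n) :=
  (contDiffOn_fderivWithin_layer hf).clm_apply contDiffOn_const

@[fun_prop]
theorem contDiffOn_tderiv {f : SpaceTime n → ℝ}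
    (hf : ContDiffOn ℝ ∞ f (layer n)) : ContDiffOn ℝ ∞ (tderiv f) (layer n) :=
  (contDiffOn_fderivWithin_layer hf).clm_apply contDiffOn_const

theorem fderivWithin_eq_of_hasFDerivWithinAt {f : SpaceTime n → ℝ} {q : SpaceTime n}
    (hq : q ∈ layer n) {f' : SpaceTime n →L[ℝ] ℝ} (h : HasFDerivWithinAt f f' (layer n) q) :
    fderivWithin ℝ f (layer n) q = f' := h.fderivWithin (uniqueDiffOn_layer q hq)

/-! ### Differentiation rules up to the walls -/

section Rules

variable {f g : SpaceTime n → ℝ} {q : SpaceTime n}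

theorem pderiv_congr (h : ∀ r ∈ layer n, f r = g r) (hq : q ∈ layer n) (j : Fin (n + 1)) :
    pderiv j f q = pderiv j g q := by
  rw [pderiv, pderiv, fderivWithin_congr h (h q hq)]

theorem pderiv_add (hf : ContDiffOn ℝ ∞ f (layer n)) (hg : ContDiffOn ℝ ∞ g (layer n))
    (hq : q ∈ layer n) (j : Fin (n + 1)) :
    pderiv j (fun r => f r + g r) q = pderiv j f q + pderiv j g q := by
  have h := (hasFDerivWithinAt_of_smooth hf hq).add (hasFDerivWithinAt_of_smooth hg hq)
  exact congrArg (fun L => L (0, Pi.single j 1)) (fderivWithin_eq_of_hasFDerivWithinAt hq h)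

theorem pderiv_sub (hf : ContDiffOn ℝ ∞ f (layer n)) (hg : ContDiffOn ℝ ∞ g (layer n))
    (hq : q ∈ layer n) (j : Fin (n + 1)) :
    pderiv j (fun r => f r - g r) q = pderiv j f q - pderiv j g q := by
  have h := (hasFDerivWithinAt_of_smooth hf hq).sub (hasFDerivWithinAt_of_smooth hg hq)
  exact congrArg (fun L => L (0, Pi.single j 1)) (fderivWithin_eq_of_hasFDerivWithinAt hq h)

theorem pderiv_sum {ι : Type*} (s : Finset ι) {F : ι → SpaceTime n → ℝ}
    (hF : ∀ i ∈ s, ContDiffOn ℝ ∞ (F i) (layer n)) (hq : q ∈ layer n) (j : Fin (n + 1)) :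
    pderiv j (fun r => ∑ i ∈ s, F i r) q = ∑ i ∈ s, pderiv j (F i) q := by
  have h := HasFDerivWithinAt.fun_sum fun i hi => hasFDerivWithinAt_of_smooth (hF i hi) hq
  refine (congrArg (fun L => L (0, Pi.single j 1))
    (fderivWithin_eq_of_hasFDerivWithinAt hq h)).trans ?_
  simp [pderiv]

theorem pderiv_mul (hf : ContDiffOn ℝ ∞ f (layer n)) (hg : ContDiffOn ℝ ∞ g (layer n))
    (hq : q ∈ layer n) (j : Fin (n + 1)) :
    pderiv j (fun r => f r * g r) q = f q * pderiv j g q + g q * pderiv j f q := by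
  have h := (hasFDerivWithinAt_of_smooth hf hq).mul (hasFDerivWithinAt_of_smooth hg hq)
  refine (congrArg (fun L => L (0, Pi.single j 1))
    (fderivWithin_eq_of_hasFDerivWithinAt hq h)).trans ?_
  simp [pderiv]

theorem pderiv_const (c : ℝ) (hq : q ∈ layer n) (j : Fin (n + 1)) :
    pderiv j (fun _ : SpaceTime n => c) q = 0 := by
  have h := hasFDerivWithinAt_const c q (layer n) (𝕜 := ℝ)
  exact congrArg (fun L => L (0, Pi.single j 1)) (fderivWithin_eq_of_hasFDerivWithinAt hq h)

theorem pderiv_const_mul (c : ℝ) (hf : ContDiffOn ℝ ∞ f (layer n)) (hq : q ∈ layer n)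
    (j : Fin (n + 1)) : pderiv j (fun r => c * f r) q = c * pderiv j f q := by
  rw [pderiv_mul contDiffOn_const hf hq, pderiv_const c hq]; ring

theorem pderiv_pow (k : ℕ) (hf : ContDiffOn ℝ ∞ f (layer n)) (hq : q ∈ layer n)
    (j : Fin (n + 1)) :
    pderiv j (fun r => f r ^ (k + 1)) q = (k + 1) * f q ^ k * pderiv j f q := by
  have h := (hasFDerivWithinAt_of_smooth hf hq).pow (k + 1)
  refine (congrArg (fun L => L (0, Pi.single j 1))
    (fderivWithin_eq_of_hasFDerivWithinAt hq h)).trans ?_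
  simp [pderiv]

theorem tderiv_sub (hf : ContDiffOn ℝ ∞ f (layer n)) (hg : ContDiffOn ℝ ∞ g (layer n))
    (hq : q ∈ layer n) : tderiv (fun r => f r - g r) q = tderiv f q - tderiv g q := by
  have h := (hasFDerivWithinAt_of_smooth hf hq).sub (hasFDerivWithinAt_of_smooth hg hq)
  exact congrArg (fun L => L (1, 0)) (fderivWithin_eq_of_hasFDerivWithinAt hq h)

theorem tderiv_mul (hf : ContDiffOn ℝ ∞ f (layer n)) (hg : ContDiffOn ℝ ∞ g (layer n))
    (hq : q ∈ layer n) :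
    tderiv (fun r => f r * g r) q = f q * tderiv g q + g q * tderiv f q := by
  have h := (hasFDerivWithinAt_of_smooth hf hq).mul (hasFDerivWithinAt_of_smooth hg hq)
  refine (congrArg (fun L => L (1, 0)) (fderivWithin_eq_of_hasFDerivWithinAt hq h)).trans ?_
  simp [tderiv]

/-- Spatial partial derivatives commute. -/
theorem pderiv_comm (hf : ContDiffOn ℝ ∞ f (layer n)) (hq : q ∈ layer n) (i j : Fin (n + 1)) :
    pderiv i (pderiv j f) q = pderiv j (pderiv i f) q := by
  have key : ∀ a b : Fin (n + 1), pderiv a (pderiv b f) q =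
      fderivWithin ℝ (fderivWithin ℝ f (layer n)) (layer n) q (0, Pi.single a 1)
        (0, Pi.single b 1) := by
    intro a b
    have h := ((contDiffOn_fderivWithin_layer hf).differentiableOn (by simp) q hq
      ).hasFDerivWithinAt.clm_apply
        (hasFDerivWithinAt_const ((0, Pi.single b 1) : SpaceTime n) q (layer n))
    refine (congrArg (fun L => L (0, Pi.single a 1))
      (fderivWithin_eq_of_hasFDerivWithinAt hq h)).trans ?_
    simp
  rw [key, key]
  exact (hf q hq).isSymmSndFDerivWithinAt
    (by simp only [minSmoothness_of_isRCLikeNormedField]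
        exact WithTop.coe_le_coe.2 (OrderTop.le_top (2 : ℕ∞))) uniqueDiffOn_layer
    (layer_subset_closure_interior hq) hq _ _

end Rules

/-! ### The depth weight, wall traces and periodicity of derivatives -/

/-- The distance `1 - x_d` to the upper wall. -/
def depth (n : ℕ) : SpaceTime n → ℝ := fun q => 1 - q.2 (Fin.last n)

@[fun_prop]
theorem contDiffOn_depth : ContDiffOn ℝ ∞ (depth n) (layer n) := by
  unfold depth; fun_prop

theorem hasFDerivWithinAt_depth (q : SpaceTime n) :
    HasFDerivWithinAt (depth n) (-((ContinuousLinearMap.proj (Fin.last n)).comp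
      (ContinuousLinearMap.snd ℝ ℝ (Fin (n + 1) → ℝ)))) (layer n) q :=
  (((ContinuousLinearMap.proj (Fin.last n)).comp
      (ContinuousLinearMap.snd ℝ ℝ (Fin (n + 1) → ℝ))).hasFDerivWithinAt).const_sub 1

theorem pderiv_depth {q : SpaceTime n} (hq : q ∈ layer n) (j : Fin (n + 1)) :
    pderiv j (depth n) q = if j = Fin.last n then -1 else 0 := by
  rw [pderiv, fderivWithin_eq_of_hasFDerivWithinAt hq (hasFDerivWithinAt_depth q)]
  by_cases h : j = Fin.last n
  · simp [h]
  · simp [h, Ne.symm h]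

theorem tderiv_depth {q : SpaceTime n} (hq : q ∈ layer n) : tderiv (depth n) q = 0 := by
  rw [tderiv, fderivWithin_eq_of_hasFDerivWithinAt hq (hasFDerivWithinAt_depth q)]
  simp

theorem depth_mem {q : SpaceTime n} (hq : q ∈ layer n) : depth n q ∈ Icc (0 : ℝ) 1 :=
  ⟨by have := hq.2.2; simp only [depth]; linarith, by have := hq.2.1; simp only [depth]; linarith⟩

theorem lowerWall_subset : lowerWall n ⊆ layer n := fun q hq => ⟨hq.1, by simp [hq.2]⟩

theorem upperWall_subset : upperWall n ⊆ layer n := fun q hq => ⟨hq.1, by simp [hq.2]⟩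

theorem depth_lower {q : SpaceTime n} (hq : q ∈ lowerWall n) : depth n q = 1 := by
  simp [depth, hq.2]

theorem depth_upper {q : SpaceTime n} (hq : q ∈ upperWall n) : depth n q = 0 := by
  simp [depth, hq.2]

/-- Horizontal derivatives of a function vanishing on a wall vanish on that wall. -/
theorem pderiv_castSucc_eq_zero {f : SpaceTime n → ℝ} (hf : ContDiffOn ℝ ∞ f (layer n))
    {q : SpaceTime n} (hq : q ∈ layer n) (i : Fin n)
    (h : ∀ s : ℝ, f (q.1, q.2 + s • Pi.single i.castSucc 1) = 0) :
    pderiv i.castSucc f q = 0 := by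
  have hc : HasDerivWithinAt (fun s : ℝ => ((q.1, q.2 + s • Pi.single i.castSucc 1) : SpaceTime n))
      (0, Pi.single i.castSucc 1) univ 0 := by
    refine (hasDerivWithinAt_const _ _ _).prodMk ?_
    simpa using ((hasDerivWithinAt_id (0 : ℝ) univ).smul_const
      (Pi.single i.castSucc 1 : Fin (n + 1) → ℝ)).const_add q.2
  have hmaps : MapsTo (fun s : ℝ => ((q.1, q.2 + s • Pi.single i.castSucc 1) : SpaceTime n))
      univ (layer n) := fun s _ =>
    ⟨hq.1, by simpa [Pi.single_apply, (Fin.castSucc_lt_last i).ne'] using hq.2⟩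
  have h1 : HasFDerivWithinAt f (fderivWithin ℝ f (layer n) q) (layer n)
      ((fun s : ℝ => ((q.1, q.2 + s • Pi.single i.castSucc 1) : SpaceTime n)) 0) := by
    simpa using hasFDerivWithinAt_of_smooth hf hq
  have h2 := h1.comp_hasDerivWithinAt (0 : ℝ) hc hmaps
  have h3 : HasDerivWithinAt (f ∘ fun s : ℝ => ((q.1, q.2 + s • Pi.single i.castSucc 1) : SpaceTime n))
      0 univ 0 := (hasDerivWithinAt_const (0 : ℝ) univ (0 : ℝ)).congr (fun s _ => h s) (h 0)
  exact (uniqueDiffWithinAt_univ.eq_deriv _ h2 h3)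

theorem pderiv_castSucc_lower {f : SpaceTime n → ℝ} (hf : ContDiffOn ℝ ∞ f (layer n))
    (h : ∀ q ∈ lowerWall n, f q = 0) {q : SpaceTime n} (hq : q ∈ lowerWall n) (i : Fin n) :
    pderiv i.castSucc f q = 0 :=
  pderiv_castSucc_eq_zero hf (lowerWall_subset hq) i fun s =>
    h _ ⟨hq.1, by simpa [Pi.single_apply, (Fin.castSucc_lt_last i).ne'] using hq.2⟩

theorem pderiv_castSucc_upper {f : SpaceTime n → ℝ} (hf : ContDiffOn ℝ ∞ f (layer n))
    (h : ∀ q ∈ upperWall n, f q = 0) {q : SpaceTime n} (hq : q ∈ upperWall n) (i : Fin n) :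
    pderiv i.castSucc f q = 0 :=
  pderiv_castSucc_eq_zero hf (upperWall_subset hq) i fun s =>
    h _ ⟨hq.1, by simpa [Pi.single_apply, (Fin.castSucc_lt_last i).ne'] using hq.2⟩

/-- The layer is invariant under horizontal translations, so the periodicity relation may be
differentiated. This removes the lateral boundary terms of fluxes containing derivatives. -/
theorem horizontallyPeriodic_pderiv {Γ : ℝ} {f : SpaceTime n → ℝ}
    (hf : ContDiffOn ℝ ∞ f (layer n)) (hp : HorizontallyPeriodic Γ f) (j : Fin (n + 1)) :
    HorizontallyPeriodic Γ (pderiv j f) := by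
  intro q hq i
  have hmaps : MapsTo (fun r : SpaceTime n => r + (0, Pi.single i.castSucc Γ)) (layer n)
      (layer n) := fun r hr => by
    refine ⟨by simpa using hr.1, ?_⟩
    simpa [Pi.single_apply, (Fin.castSucc_lt_last i).ne'] using hr.2
  have he : (q.1, q.2 + Pi.single i.castSucc Γ) = q + ((0, Pi.single i.castSucc Γ) : SpaceTime n) :=
    Prod.ext (by simp) rfl
  have h1 := hasFDerivWithinAt_of_smooth hf (hmaps hq)
  have h2 : HasFDerivWithinAt (fun r : SpaceTime n => r + (0, Pi.single i.castSucc Γ))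
      (ContinuousLinearMap.id ℝ (SpaceTime n)) (layer n) q := (hasFDerivWithinAt_id q _).add_const _
  have h3 := h1.comp q h2 hmaps
  have h4 : HasFDerivWithinAt f _ (layer n) q := h3.congr
    (fun r hr => (hp r hr i).symm.trans (congrArg f (Prod.ext (by simp) rfl)))
    ((hp q hq i).symm.trans (congrArg f (Prod.ext (by simp) rfl)))
  simp only [pderiv]
  rw [fderivWithin_eq_of_hasFDerivWithinAt hq h4, he]
  rfl

/-! ### Integration over the cell and in time -/

/-- The integral of `f` over the periodicity cell at time `t`. -/
noncomputable def cellIntegral (Γ t : ℝ) (f : SpaceTime n → ℝ) : ℝ := ∫ x in cell n Γ, f (t, x)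

section Cell

variable {Γ t : ℝ}

theorem isCompact_cell : IsCompact (cell n Γ) := isCompact_Icc

theorem measurableSet_cell : MeasurableSet (cell n Γ) := measurableSet_Icc

theorem mem_layer_of_mem_cell (ht : 0 < t) {x : Fin (n + 1) → ℝ} (hx : x ∈ cell n Γ) :
    (t, x) ∈ layer n :=
  ⟨ht, by simpa using hx.1 (Fin.last n), by simpa using hx.2 (Fin.last n)⟩

theorem volume_real_cell (hΓ : 0 < Γ) : volume.real (cell n Γ) = Γ ^ n := by
  rw [measureReal_def, cell, Real.volume_Icc_pi_toReal]
  · simp [Fin.prod_univ_castSucc, (Fin.castSucc_lt_last _).ne]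
  · intro i; by_cases h : i = Fin.last n <;> simp [h, hΓ.le]

theorem continuousOn_slice {f : SpaceTime n → ℝ} (hf : ContinuousOn f (layer n)) (ht : 0 < t) :
    ContinuousOn (fun x => f (t, x)) (cell n Γ) :=
  hf.comp (by fun_prop) fun _ hx => mem_layer_of_mem_cell ht hx

theorem integrableOn_slice {f : SpaceTime n → ℝ} (hf : ContDiffOn ℝ ∞ f (layer n)) (ht : 0 < t) :
    IntegrableOn (fun x => f (t, x)) (cell n Γ) :=
  (continuousOn_slice hf.continuousOn ht).integrableOn_compact isCompact_cell

variable {f g : SpaceTime n → ℝ}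

theorem cellIntegral_congr (ht : 0 < t) (h : ∀ q ∈ layer n, f q = g q) :
    cellIntegral Γ t f = cellIntegral Γ t g :=
  setIntegral_congr_fun measurableSet_cell fun _ hx => h _ (mem_layer_of_mem_cell ht hx)

theorem cellIntegral_mono (ht : 0 < t) (hf : ContDiffOn ℝ ∞ f (layer n))
    (hg : ContDiffOn ℝ ∞ g (layer n)) (h : ∀ q ∈ layer n, f q ≤ g q) :
    cellIntegral Γ t f ≤ cellIntegral Γ t g :=
  setIntegral_mono_on (integrableOn_slice hf ht) (integrableOn_slice hg ht) measurableSet_cell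
    fun _ hx => h _ (mem_layer_of_mem_cell ht hx)

theorem cellIntegral_nonneg (ht : 0 < t) (h : ∀ q ∈ layer n, 0 ≤ f q) :
    0 ≤ cellIntegral Γ t f :=
  setIntegral_nonneg measurableSet_cell fun _ hx => h _ (mem_layer_of_mem_cell ht hx)

theorem cellIntegral_add (ht : 0 < t) (hf : ContDiffOn ℝ ∞ f (layer n))
    (hg : ContDiffOn ℝ ∞ g (layer n)) :
    cellIntegral Γ t (fun q => f q + g q) = cellIntegral Γ t f + cellIntegral Γ t g :=
  integral_add (integrableOn_slice hf ht) (integrableOn_slice hg ht)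

theorem cellIntegral_sub (ht : 0 < t) (hf : ContDiffOn ℝ ∞ f (layer n))
    (hg : ContDiffOn ℝ ∞ g (layer n)) :
    cellIntegral Γ t (fun q => f q - g q) = cellIntegral Γ t f - cellIntegral Γ t g :=
  integral_sub (integrableOn_slice hf ht) (integrableOn_slice hg ht)

theorem cellIntegral_sum (ht : 0 < t) {ι : Type*} (s : Finset ι) {F : ι → SpaceTime n → ℝ}
    (hF : ∀ i ∈ s, ContDiffOn ℝ ∞ (F i) (layer n)) :
    cellIntegral Γ t (fun q => ∑ i ∈ s, F i q) = ∑ i ∈ s, cellIntegral Γ t (F i) :=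
  integral_finsetSum s fun i hi => integrableOn_slice (hF i hi) ht

theorem cellIntegral_const_mul (c : ℝ) :
    cellIntegral Γ t (fun q => c * f q) = c * cellIntegral Γ t f :=
  integral_const_mul c _

theorem cellIntegral_const (hΓ : 0 < Γ) (c : ℝ) :
    cellIntegral Γ t (fun _ : SpaceTime n => c) = Γ ^ n * c := by
  rw [cellIntegral, setIntegral_const, volume_real_cell hΓ, smul_eq_mul]

theorem hasFDerivAt_slice (hf : ContDiffOn ℝ ∞ f (layer n)) {x : Fin (n + 1) → ℝ}
    (hx : (t, x) ∈ openLayer n) :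
    HasFDerivAt (fun y => f (t, y)) ((fderivWithin ℝ f (layer n) (t, x)).comp
      (ContinuousLinearMap.inr ℝ ℝ (Fin (n + 1) → ℝ))) x :=
  ((hasFDerivWithinAt_of_smooth hf (openLayer_subset hx)).hasFDerivAt
    (mem_interior_iff_mem_nhds.1 (openLayer_subset_interior hx))).comp x
      (hasFDerivAt_prodMk_right t x)

/-- The divergence theorem in the periodicity cell for a field in a coordinate direction. -/
theorem cellIntegral_pderiv (hΓ : 0 < Γ) (ht : 0 < t) (hf : ContDiffOn ℝ ∞ f (layer n))
    (j : Fin (n + 1)) :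
    cellIntegral Γ t (pderiv j f) =
      (∫ y in Icc ((0 : Fin (n + 1) → ℝ) ∘ j.succAbove)
          ((fun i => if i = Fin.last n then (1 : ℝ) else Γ) ∘ j.succAbove),
        f (t, j.insertNth (if j = Fin.last n then (1 : ℝ) else Γ) y)) -
      ∫ y in Icc ((0 : Fin (n + 1) → ℝ) ∘ j.succAbove)
          ((fun i => if i = Fin.last n then (1 : ℝ) else Γ) ∘ j.succAbove),
        f (t, j.insertNth (0 : ℝ) y) := by
  have hle : (0 : Fin (n + 1) → ℝ) ≤ fun i => if i = Fin.last n then (1 : ℝ) else Γ := by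
    intro i; by_cases h : i = Fin.last n <;> simp [h, hΓ.le]
  have key : ∀ x : Fin (n + 1) → ℝ, (∑ i, (if i = j then
      (fderivWithin ℝ f (layer n) (t, x)).comp (ContinuousLinearMap.inr ℝ ℝ (Fin (n + 1) → ℝ))
      else 0) (Pi.single i 1)) = pderiv j f (t, x) := by
    intro x
    rw [Finset.sum_eq_single j]
    · simp [pderiv]
    · intro i _ hi; simp [hi]
    · simp
  -- The field has `f` as its component `j` and zero elsewhere, so only the two faces normal to `j`
  -- survive.
  have h := integral_divergence_of_hasFDerivAt_off_countable' (E := ℝ) 0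
    (fun i => if i = Fin.last n then (1 : ℝ) else Γ) hle
    (fun i x => if i = j then f (t, x) else 0)
    (fun i x => if i = j then (fderivWithin ℝ f (layer n) (t, x)).comp
      (ContinuousLinearMap.inr ℝ ℝ (Fin (n + 1) → ℝ)) else 0) ∅ countable_empty ?_ ?_ ?_
  · simp only [key] at h
    rw [cellIntegral, cell, h, Finset.sum_eq_single j]
    · simp
    · intro i _ hi; simp [hi]
    · simp
  · intro i
    by_cases h : i = j
    · simp only [h, if_true]; exact continuousOn_slice hf.continuousOn ht
    · simp only [h, if_false]; exact continuousOn_const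
  · intro x hx i
    by_cases h : i = j
    · simp only [h, if_true]
      refine hasFDerivAt_slice hf ⟨ht, ?_⟩
      simpa using hx.1 (Fin.last n) (mem_univ _)
    · simp only [h, if_false]; exact hasFDerivAt_const _ _
  · simp only [key]; exact integrableOn_slice (contDiffOn_pderiv j hf) ht

theorem cellIntegral_pderiv_castSucc (hΓ : 0 < Γ) (ht : 0 < t)
    (hf : ContDiffOn ℝ ∞ f (layer n)) (hp : HorizontallyPeriodic Γ f) (i : Fin n) :
    cellIntegral Γ t (pderiv i.castSucc f) = 0 := by
  rw [cellIntegral_pderiv hΓ ht hf, sub_eq_zero]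
  refine setIntegral_congr_fun measurableSet_Icc fun y hy => ?_
  have hne := (Fin.castSucc_lt_last i).ne
  simp only [hne, if_false]
  have hmem : (t, (i.castSucc.insertNth (0 : ℝ) y : Fin (n + 1) → ℝ)) ∈ layer n := by
    refine ⟨ht, ?_⟩
    obtain ⟨k, hk⟩ := Fin.exists_succAbove_eq hne.symm
    simp only
    rw [← hk, Fin.insertNth_apply_succAbove]
    have h1 := hy.1 k
    have h2 := hy.2 k
    simp only [Function.comp_apply, hk, if_true, Pi.zero_apply] at h1 h2
    exact ⟨h1, h2⟩
  -- The face at `Γ` is the translate by one period of the face at `0`.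
  rw [← hp _ hmem i]
  congr 2
  ext k
  rcases Fin.eq_self_or_eq_succAbove i.castSucc k with rfl | ⟨k, rfl⟩
  · simp
  · simp [Fin.succAbove_ne]

theorem cellIntegral_pderiv_last_nonpos (hΓ : 0 < Γ) (ht : 0 < t)
    (hf : ContDiffOn ℝ ∞ f (layer n)) (h0 : ∀ q ∈ lowerWall n, 0 ≤ f q)
    (h1 : ∀ q ∈ upperWall n, f q ≤ 0) : cellIntegral Γ t (pderiv (Fin.last n) f) ≤ 0 := by
  rw [cellIntegral_pderiv hΓ ht hf]
  refine sub_nonpos.2 (le_trans (setIntegral_nonpos measurableSet_Icc fun y _ => ?_)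
    (setIntegral_nonneg measurableSet_Icc fun y _ => ?_))
  · exact h1 _ ⟨ht, by simp⟩
  · exact h0 _ ⟨ht, by simp⟩

theorem cellIntegral_pderiv_last (hΓ : 0 < Γ) (ht : 0 < t)
    (hf : ContDiffOn ℝ ∞ f (layer n)) (h0 : ∀ q ∈ lowerWall n, f q = 0)
    (h1 : ∀ q ∈ upperWall n, f q = 0) : cellIntegral Γ t (pderiv (Fin.last n) f) = 0 := by
  rw [cellIntegral_pderiv hΓ ht hf, sub_eq_zero]
  refine setIntegral_congr_fun measurableSet_Icc fun y _ => ?_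
  exact (h1 _ ⟨ht, by simp⟩).trans (h0 _ ⟨ht, by simp⟩).symm

/-- A horizontally periodic smooth field tangential to the walls has mean divergence zero. -/
theorem cellIntegral_divergence (hΓ : 0 < Γ) (ht : 0 < t) {V : Fin (n + 1) → SpaceTime n → ℝ}
    (hV : ∀ j, ContDiffOn ℝ ∞ (V j) (layer n)) (hp : ∀ i : Fin n, HorizontallyPeriodic Γ (V i.castSucc))
    (h0 : ∀ q ∈ lowerWall n, V (Fin.last n) q = 0)
    (h1 : ∀ q ∈ upperWall n, V (Fin.last n) q = 0) :
    cellIntegral Γ t (fun q => ∑ j, pderiv j (V j) q) = 0 := by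
  rw [cellIntegral_sum ht _ fun j _ => contDiffOn_pderiv j (hV j), Fin.sum_univ_castSucc,
    cellIntegral_pderiv_last hΓ ht (hV _) h0 h1, add_zero]
  exact Finset.sum_eq_zero fun i _ => cellIntegral_pderiv_castSucc hΓ ht (hV _) (hp i) i

/-- Variant of the divergence theorem with a sign at the walls. -/
theorem cellIntegral_divergence_nonpos (hΓ : 0 < Γ) (ht : 0 < t)
    {V : Fin (n + 1) → SpaceTime n → ℝ} (hV : ∀ j, ContDiffOn ℝ ∞ (V j) (layer n))
    (hp : ∀ i : Fin n, HorizontallyPeriodic Γ (V i.castSucc))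
    (h0 : ∀ q ∈ lowerWall n, 0 ≤ V (Fin.last n) q)
    (h1 : ∀ q ∈ upperWall n, V (Fin.last n) q ≤ 0) :
    cellIntegral Γ t (fun q => ∑ j, pderiv j (V j) q) ≤ 0 := by
  rw [cellIntegral_sum ht _ fun j _ => contDiffOn_pderiv j (hV j), Fin.sum_univ_castSucc,
    Finset.sum_eq_zero fun i _ => cellIntegral_pderiv_castSucc hΓ ht (hV _) (hp i) i, zero_add]
  exact cellIntegral_pderiv_last_nonpos hΓ ht (hV _) h0 h1

/-- Continuity in time of the cell integral. -/
theorem continuousOn_cellIntegral (hf : ContinuousOn f (layer n)) :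
    ContinuousOn (fun t => cellIntegral Γ t f) (Ioi 0) := by
  intro t₀ ht₀
  have ht₀' : (0 : ℝ) < t₀ := ht₀
  -- A compact time window away from `0` supplies the constant dominating function.
  have hsub : ∀ q ∈ Icc (t₀ / 2) (2 * t₀) ×ˢ cell n Γ, (q : SpaceTime n) ∈ layer n :=
    fun q hq => mem_layer_of_mem_cell (t := q.1) (x := q.2)
      (lt_of_lt_of_le (by positivity) hq.1.1) hq.2
  have hU : Icc (t₀ / 2) (2 * t₀) ∈ 𝓝 t₀ := Icc_mem_nhds (by linarith) (by linarith)
  obtain ⟨M, hM⟩ := ((isCompact_Icc.prod (isCompact_cell (n := n) (Γ := Γ))).bddAbove_image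
    (hf.norm.mono hsub))
  refine (continuousAt_of_dominated (bound := fun _ => M) ?_ ?_ ?_ ?_).continuousWithinAt
  · filter_upwards [hU] with t ht
    exact (continuousOn_slice hf (lt_of_lt_of_le (by positivity) ht.1)).aestronglyMeasurable
      measurableSet_cell
  · filter_upwards [hU] with t ht
    filter_upwards [ae_restrict_mem measurableSet_cell] with x hx
    exact hM (mem_image_of_mem _ (mk_mem_prod ht hx))
  · exact integrableOn_const isCompact_cell.measure_ne_top
  · filter_upwards [ae_restrict_mem measurableSet_cell] with x hx
    have hc : ContinuousOn (fun t => f (t, x)) (Ioi 0) :=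
      hf.comp (by fun_prop) fun t ht => mem_layer_of_mem_cell ht hx
    exact hc.continuousAt (Ioi_mem_nhds ht₀')

/-- The fundamental theorem of calculus in time, integrated over the cell. -/
theorem integral_cellIntegral_tderiv (hf : ContDiffOn ℝ ∞ f (layer n)) {a b : ℝ} (ha : 0 < a)
    (hab : a ≤ b) :
    ∫ t in a..b, cellIntegral Γ t (tderiv f) = cellIntegral Γ b f - cellIntegral Γ a f := by
  have hsub : ∀ t ∈ uIcc a b, 0 < t := fun t ht => ha.trans_le (by
    rw [uIcc_of_le hab] at ht; exact ht.1)
  have hcont : ContinuousOn (Function.uncurry fun (t : ℝ) (x : Fin (n + 1) → ℝ) =>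
      tderiv f (t, x)) (Icc a b ×ˢ cell n Γ) :=
    (contDiffOn_tderiv hf).continuousOn.mono fun q hq =>
      mem_layer_of_mem_cell (t := q.1) (x := q.2) (ha.trans_le hq.1.1) hq.2
  have hint : Integrable (Function.uncurry fun (t : ℝ) (x : Fin (n + 1) → ℝ) =>
      tderiv f (t, x)) ((volume.restrict (Ioc a b)).prod (volume.restrict (cell n Γ))) := by
    rw [Measure.prod_restrict]
    exact (hcont.integrableOn_compact (isCompact_Icc.prod isCompact_cell)).mono_set
      (prod_mono Ioc_subset_Icc_self le_rfl)
  simp only [cellIntegral]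
  rw [intervalIntegral.integral_of_le hab, integral_integral_swap hint,
    ← integral_sub (integrableOn_slice hf (ha.trans_le hab)) (integrableOn_slice hf ha)]
  refine setIntegral_congr_fun measurableSet_cell fun x hx => ?_
  rw [← intervalIntegral.integral_of_le hab]
  refine intervalIntegral.integral_eq_sub_of_hasDerivAt (f := fun t => f (t, x)) (fun t ht => ?_) ?_
  · have hc : HasDerivWithinAt (fun s : ℝ => ((s, x) : SpaceTime n)) (1, 0) (Ioi 0) t :=
      (hasDerivWithinAt_id t _).prodMk (hasDerivWithinAt_const _ _ _)
    have h := (hasFDerivWithinAt_of_smooth hf (mem_layer_of_mem_cell (hsub t ht) hx)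
      ).comp_hasDerivWithinAt t hc fun s hs => mem_layer_of_mem_cell hs hx
    exact h.hasDerivAt (Ioi_mem_nhds (hsub t ht))
  · refine ContinuousOn.intervalIntegrable ?_
    exact (contDiffOn_tderiv hf).continuousOn.comp (by fun_prop)
      fun t ht => mem_layer_of_mem_cell (hsub t ht) hx

end Cell

/-! ### Stokes estimates uniform in the slip length -/

/-- The square of the norm of the spatial gradient. -/
noncomputable def gradSq (f : SpaceTime n → ℝ) : SpaceTime n → ℝ := fun q => ∑ k, pderiv k f q ^ 2

@[fun_prop]
theorem contDiffOn_gradSq {f : SpaceTime n → ℝ} (hf : ContDiffOn ℝ ∞ f (layer n)) :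
    ContDiffOn ℝ ∞ (gradSq f) (layer n) := by
  unfold gradSq; fun_prop

@[fun_prop]
theorem contDiffOn_laplacian {f : SpaceTime n → ℝ} (hf : ContDiffOn ℝ ∞ f (layer n)) :
    ContDiffOn ℝ ∞ (laplacian f) (layer n) := by
  unfold laplacian; fun_prop

theorem HorizontallyPeriodic.mul {Γ : ℝ} {f g : SpaceTime n → ℝ} (hf : HorizontallyPeriodic Γ f)
    (hg : HorizontallyPeriodic Γ g) : HorizontallyPeriodic Γ (fun q => f q * g q) :=
  fun q hq i => by simp only [hf q hq i, hg q hq i]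

theorem HorizontallyPeriodic.sum {Γ : ℝ} {ι : Type*} (s : Finset ι) {F : ι → SpaceTime n → ℝ}
    (hF : ∀ i, HorizontallyPeriodic Γ (F i)) : HorizontallyPeriodic Γ (fun q => ∑ i ∈ s, F i q) :=
  fun q hq i => Finset.sum_congr rfl fun k _ => hF k q hq i

theorem laplacian_pderiv {f : SpaceTime n → ℝ} (hf : ContDiffOn ℝ ∞ f (layer n))
    {q : SpaceTime n} (hq : q ∈ layer n) (i : Fin (n + 1)) :
    laplacian (pderiv i f) q = pderiv i (laplacian f) q := by
  unfold laplacian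
  rw [pderiv_sum _ (fun j _ => by fun_prop) hq]
  refine Finset.sum_congr rfl fun j _ => ?_
  rw [pderiv_comm (f := pderiv j f) (by fun_prop) hq i j]
  exact pderiv_congr (fun r hr => pderiv_comm hf hr j i) hq j

/-- Smooth horizontally periodic solutions of the Stokes system with vertical forcing `Ra S` and
Navier-slip conditions. -/
structure IsStokesSolution (n : ℕ) (Γ Ls Ra : ℝ) (v : Fin (n + 1) → SpaceTime n → ℝ)
    (p S : SpaceTime n → ℝ) : Prop where
  smooth_v : ∀ j, ContDiffOn ℝ ∞ (v j) (layer n)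
  smooth_p : ContDiffOn ℝ ∞ p (layer n)
  smooth_S : ContDiffOn ℝ ∞ S (layer n)
  periodic_v : ∀ j, HorizontallyPeriodic Γ (v j)
  periodic_p : HorizontallyPeriodic Γ p
  momentum : ∀ q ∈ layer n, ∀ j : Fin (n + 1),
    pderiv j p q - laplacian (v j) q = if j = Fin.last n then Ra * S q else 0
  incompressible : ∀ q ∈ layer n, ∑ j, pderiv j (v j) q = 0
  slip_lower : ∀ q ∈ lowerWall n, ∀ i : Fin n,
    pderiv (Fin.last n) (v i.castSucc) q = 1 / Ls * v i.castSucc q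
  slip_upper : ∀ q ∈ upperWall n, ∀ i : Fin n,
    -pderiv (Fin.last n) (v i.castSucc) q = 1 / Ls * v i.castSucc q
  no_flux_lower : ∀ q ∈ lowerWall n, v (Fin.last n) q = 0
  no_flux_upper : ∀ q ∈ upperWall n, v (Fin.last n) q = 0

section Stokes

variable {Γ Ls Ra t : ℝ} {v : Fin (n + 1) → SpaceTime n → ℝ} {p S : SpaceTime n → ℝ}

/-- The energy inequality of the Stokes system. -/
theorem IsStokesSolution.energy (h : IsStokesSolution n Γ Ls Ra v p S) (hΓ : 0 < Γ) (hLs : 0 < Ls)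
    (ht : 0 < t) :
    cellIntegral Γ t (fun q => ∑ j, gradSq (v j) q) ≤
      Ra * cellIntegral Γ t (fun q => S q * v (Fin.last n) q) := by
  have hv := h.smooth_v
  have hp := h.smooth_p
  have hS := h.smooth_S
  have hpress : cellIntegral Γ t (fun q => ∑ j, pderiv j (fun r => v j r * p r) q) = 0 := by
    refine cellIntegral_divergence hΓ ht (fun j => by fun_prop)
      (fun i => (h.periodic_v _).mul h.periodic_p) (fun q hq => ?_) fun q hq => ?_
    · simp only [h.no_flux_lower q hq, zero_mul]
    · simp only [h.no_flux_upper q hq, zero_mul]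
  -- By the slip conditions the vertical flux is `1 / Ls * ∑ v_i ^ 2` at the lower wall and its
  -- negative at the upper one, so both walls contribute with the sign that may be discarded.
  have hvisc : cellIntegral Γ t
      (fun q => ∑ k, pderiv k (fun r => ∑ j, v j r * pderiv k (v j) r) q) ≤ 0 := by
    refine cellIntegral_divergence_nonpos hΓ ht (fun k => by fun_prop)
      (fun i => HorizontallyPeriodic.sum _ fun j =>
        (h.periodic_v _).mul (horizontallyPeriodic_pderiv (hv j) (h.periodic_v j) _))
      (fun q hq => ?_) fun q hq => ?_
    · simp only [Fin.sum_univ_castSucc, h.no_flux_lower q hq, zero_mul, add_zero,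
        h.slip_lower q hq]
      refine Finset.sum_nonneg fun i _ => ?_
      have : 0 ≤ 1 / Ls * v i.castSucc q ^ 2 := by positivity
      linarith
    · simp only [Fin.sum_univ_castSucc, h.no_flux_upper q hq, zero_mul, add_zero]
      refine Finset.sum_nonpos fun i _ => ?_
      have h1 := h.slip_upper q hq i
      have : 0 ≤ 1 / Ls * v i.castSucc q ^ 2 := by positivity
      have h2 : pderiv (Fin.last n) (v i.castSucc) q = -(1 / Ls * v i.castSucc q) := by linarith
      rw [h2]; linarith
  have key : ∀ q ∈ layer n, ∑ j, gradSq (v j) q =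
      (Ra * (S q * v (Fin.last n) q) - ∑ j, pderiv j (fun r => v j r * p r) q) +
        ∑ k, pderiv k (fun r => ∑ j, v j r * pderiv k (v j) r) q := by
    intro q hq
    have h1 : ∑ j, pderiv j (fun r => v j r * p r) q = ∑ j, v j q * pderiv j p q := by
      simp only [pderiv_mul (hv _) hp hq, Finset.sum_add_distrib]
      rw [← Finset.mul_sum, h.incompressible q hq, mul_zero, add_zero]
    have h2 : ∑ k, pderiv k (fun r => ∑ j, v j r * pderiv k (v j) r) q =
        ∑ j, (v j q * laplacian (v j) q + gradSq (v j) q) := by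
      have : ∀ k, pderiv k (fun r => ∑ j, v j r * pderiv k (v j) r) q =
          ∑ j, (v j q * pderiv k (pderiv k (v j)) q + pderiv k (v j) q ^ 2) := fun k => by
        rw [pderiv_sum _ (fun j _ => by fun_prop) hq]
        refine Finset.sum_congr rfl fun j _ => ?_
        rw [pderiv_mul (hv j) (by fun_prop) hq]; ring
      simp only [this]
      rw [Finset.sum_comm]
      simp only [laplacian, gradSq, Finset.mul_sum, Finset.sum_add_distrib]
    have h3 : Ra * (S q * v (Fin.last n) q) =
        ∑ j, v j q * (pderiv j p q - laplacian (v j) q) := by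
      simp only [h.momentum q hq]
      simp only [mul_ite, mul_zero, Finset.sum_ite_eq', Finset.mem_univ, if_true]
      ring
    rw [h1, h2, h3, Finset.sum_add_distrib]
    simp only [mul_sub, Finset.sum_sub_distrib]
    ring
  rw [cellIntegral_congr ht key, cellIntegral_add ht (by fun_prop) (by fun_prop),
    cellIntegral_sub ht (by fun_prop) (by fun_prop), hpress, cellIntegral_const_mul]
  linarith

/-- Horizontal derivatives of Stokes solutions are Stokes solutions. -/
theorem IsStokesSolution.pderiv (h : IsStokesSolution n Γ Ls Ra v p S) (i : Fin n) :
    IsStokesSolution n Γ Ls Ra (fun j => pderiv i.castSucc (v j)) (pderiv i.castSucc p)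
      (pderiv i.castSucc S) where
  smooth_v j := contDiffOn_pderiv _ (h.smooth_v j)
  smooth_p := contDiffOn_pderiv _ h.smooth_p
  smooth_S := contDiffOn_pderiv _ h.smooth_S
  periodic_v j := horizontallyPeriodic_pderiv (h.smooth_v j) (h.periodic_v j) _
  periodic_p := horizontallyPeriodic_pderiv h.smooth_p h.periodic_p _
  momentum q hq j := by
    have hp := h.smooth_p
    have hv := h.smooth_v j
    rw [laplacian_pderiv hv hq, pderiv_comm hp hq,
      ← pderiv_sub (by fun_prop) (by fun_prop) hq,
      pderiv_congr (fun r hr => h.momentum r hr j) hq]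
    by_cases hj : j = Fin.last n
    · simp only [hj, if_true]; exact pderiv_const_mul Ra h.smooth_S hq _
    · simp only [hj, if_false]; exact pderiv_const 0 hq _
  incompressible q hq := by
    have hv := h.smooth_v
    simp only [fun j => pderiv_comm (hv j) hq j i.castSucc]
    rw [← pderiv_sum _ (fun j _ => by fun_prop) hq, pderiv_congr h.incompressible hq,
      pderiv_const 0 hq]
  slip_lower q hq k := by
    have hv := h.smooth_v k.castSucc
    have hq' := lowerWall_subset hq
    -- The slip relation holds along the whole wall, so horizontal derivatives preserve it.
    have := pderiv_castSucc_lower (f := fun r => RayleighBenard.pderiv (Fin.last n) (v k.castSucc) r -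
      1 / Ls * v k.castSucc r) (by fun_prop) (fun r hr => sub_eq_zero.2 (h.slip_lower r hr k)) hq i
    rw [pderiv_sub (by fun_prop) (by fun_prop) hq', pderiv_const_mul _ hv hq', sub_eq_zero] at this
    rw [pderiv_comm hv hq', this]
  slip_upper q hq k := by
    have hv := h.smooth_v k.castSucc
    have hq' := upperWall_subset hq
    have := pderiv_castSucc_upper (f := fun r => RayleighBenard.pderiv (Fin.last n) (v k.castSucc) r +
      1 / Ls * v k.castSucc r) (by fun_prop)
      (fun r hr => by rw [← h.slip_upper r hr k]; ring) hq i
    rw [pderiv_add (by fun_prop) (by fun_prop) hq', pderiv_const_mul _ hv hq'] at this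
    rw [pderiv_comm hv hq']; linarith
  no_flux_lower q hq := pderiv_castSucc_lower (h.smooth_v _) h.no_flux_lower hq i
  no_flux_upper q hq := pderiv_castSucc_upper (h.smooth_v _) h.no_flux_upper hq i

/-- Bound on the second vertical derivative of the vertical velocity. -/
theorem IsStokesSolution.integral_pderiv_last_last_sq_le (h : IsStokesSolution n Γ Ls Ra v p S)
    (hΓ : 0 < Γ) (hLs : 0 < Ls) (hRa : 0 < Ra) (ht : 0 < t) {κ : ℝ} (hκ : 0 < κ) :
    cellIntegral Γ t
        (fun q => RayleighBenard.pderiv (Fin.last n)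
          (RayleighBenard.pderiv (Fin.last n) (v (Fin.last n))) q ^ 2) ≤
      n * Ra / 2 * (κ * cellIntegral Γ t (gradSq S) +
        κ⁻¹ * cellIntegral Γ t (fun q => ∑ j, gradSq (v j) q)) := by
  have hv := h.smooth_v
  have hS := h.smooth_S
  -- Incompressibility gives `∂_d² v_d = -∑ ∂_d ∂_i v_i`; the factor `n` is Cauchy–Schwarz for the
  -- horizontal sum.
  have hpt : ∀ q ∈ layer n, RayleighBenard.pderiv (Fin.last n)
      (RayleighBenard.pderiv (Fin.last n) (v (Fin.last n))) q ^ 2 ≤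
      n * ∑ i : Fin n, ∑ j, gradSq (RayleighBenard.pderiv i.castSucc (v j)) q := by
    intro q hq
    have h1 : RayleighBenard.pderiv (Fin.last n) (RayleighBenard.pderiv (Fin.last n) (v (Fin.last n))) q =
        -∑ i : Fin n, RayleighBenard.pderiv (Fin.last n)
          (RayleighBenard.pderiv i.castSucc (v i.castSucc)) q := by
      have h2 := pderiv_congr h.incompressible hq (Fin.last n)
      rw [pderiv_const 0 hq, pderiv_sum _ (fun j _ => by fun_prop) hq,
        Fin.sum_univ_castSucc] at h2
      linarith
    rw [h1, neg_sq]
    refine (sq_sum_le_card_mul_sum_sq).trans ?_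
    rw [Finset.card_univ, Fintype.card_fin]
    refine mul_le_mul_of_nonneg_left (Finset.sum_le_sum fun i _ => ?_) (Nat.cast_nonneg n)
    refine le_trans ?_ (Finset.single_le_sum (f := fun j =>
      gradSq (RayleighBenard.pderiv i.castSucc (v j)) q)
      (fun j _ => Finset.sum_nonneg fun k _ => sq_nonneg _) (Finset.mem_univ i.castSucc))
    exact Finset.single_le_sum (f := fun k => RayleighBenard.pderiv k
      (RayleighBenard.pderiv i.castSucc (v i.castSucc)) q ^ 2)
      (fun j _ => sq_nonneg _) (Finset.mem_univ (Fin.last n))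
  have hcross : ∀ q ∈ layer n, ∑ i : Fin n, RayleighBenard.pderiv i.castSucc S q *
      RayleighBenard.pderiv i.castSucc (v (Fin.last n)) q ≤
      κ / 2 * gradSq S q + κ⁻¹ / 2 * ∑ j, gradSq (v j) q := by
    intro q hq
    have h1 : ∀ i : Fin n, RayleighBenard.pderiv i.castSucc S q *
        RayleighBenard.pderiv i.castSucc (v (Fin.last n)) q ≤
        κ / 2 * RayleighBenard.pderiv i.castSucc S q ^ 2 +
          κ⁻¹ / 2 * RayleighBenard.pderiv i.castSucc (v (Fin.last n)) q ^ 2 := by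
      intro i
      set a := RayleighBenard.pderiv i.castSucc S q
      set b := RayleighBenard.pderiv i.castSucc (v (Fin.last n)) q
      have : 0 ≤ κ⁻¹ / 2 * (κ * a - b) ^ 2 := by positivity
      have e : κ⁻¹ / 2 * (κ * a - b) ^ 2 = κ / 2 * a ^ 2 - a * b + κ⁻¹ / 2 * b ^ 2 := by
        field_simp; ring
      linarith
    have h2 : ∀ f : SpaceTime n → ℝ,
        ∑ i : Fin n, RayleighBenard.pderiv i.castSucc f q ^ 2 ≤ gradSq f q := fun f => by
      rw [gradSq, Fin.sum_univ_castSucc]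
      exact le_add_of_nonneg_right (sq_nonneg _)
    have h3 : gradSq (v (Fin.last n)) q ≤ ∑ j, gradSq (v j) q :=
      Finset.single_le_sum (f := fun j => gradSq (v j) q)
        (fun j _ => Finset.sum_nonneg fun k _ => sq_nonneg _) (Finset.mem_univ _)
    refine (Finset.sum_le_sum fun i _ => h1 i).trans ?_
    rw [Finset.sum_add_distrib, ← Finset.mul_sum, ← Finset.mul_sum]
    gcongr
    · exact h2 S
    · exact (h2 _).trans h3
  -- The energy inequality for each horizontally differentiated system, whose forcing is `Ra * ∂_i
  -- S`.
  have henergy : cellIntegral Γ t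
      (fun q => ∑ i : Fin n, ∑ j, gradSq (RayleighBenard.pderiv i.castSucc (v j)) q) ≤
      Ra * cellIntegral Γ t (fun q => ∑ i : Fin n, RayleighBenard.pderiv i.castSucc S q *
        RayleighBenard.pderiv i.castSucc (v (Fin.last n)) q) := by
    rw [cellIntegral_sum ht _ (fun i _ => by fun_prop),
      cellIntegral_sum ht _ (fun i _ => by fun_prop), Finset.mul_sum]
    exact Finset.sum_le_sum fun i _ => (h.pderiv i).energy hΓ hLs ht
  have hmain := cellIntegral_mono (Γ := Γ) ht (by fun_prop) (by fun_prop) hpt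
  have hcr := cellIntegral_mono (Γ := Γ) ht (by fun_prop) (by fun_prop) hcross
  rw [cellIntegral_const_mul] at hmain
  rw [cellIntegral_add ht (by fun_prop) (by fun_prop), cellIntegral_const_mul,
    cellIntegral_const_mul] at hcr
  calc _ ≤ _ := hmain
    _ ≤ n * (Ra * (κ / 2 * cellIntegral Γ t (gradSq S) +
        κ⁻¹ / 2 * cellIntegral Γ t (fun q => ∑ j, gradSq (v j) q))) := by
      gcongr
      exact henergy.trans (by gcongr)
    _ = _ := by ring

end Stokes

/-- The Stokes structure forgets the heat equation and the wall temperatures, and is therefore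
closed under horizontal differentiation. -/
theorem IsSolution.isStokesSolution {Γ Ls Ra : ℝ} {u : SpaceTime n → Fin (n + 1) → ℝ}
    {p T : SpaceTime n → ℝ} (h : IsSolution n Γ Ls Ra u p T) :
    IsStokesSolution n Γ Ls Ra (fun j q => u q j) p T where
  smooth_v j := contDiffOn_pi.1 h.smooth_u j
  smooth_p := h.smooth_p
  smooth_S := h.smooth_T
  periodic_v j q hq i := congrFun (h.periodic_u q hq i) j
  periodic_p := h.periodic_p
  momentum := h.momentum
  incompressible := h.incompressible
  slip_lower := h.slip_lower
  slip_upper := h.slip_upper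
  no_flux_lower := h.no_flux_lower
  no_flux_upper := h.no_flux_upper

theorem horizontallyPeriodic_depth {Γ : ℝ} : HorizontallyPeriodic Γ (depth n) :=
  fun q _ i => by simp [depth, (Fin.castSucc_lt_last i).ne]

theorem pderiv_depth_last {q : SpaceTime n} (hq : q ∈ layer n) :
    pderiv (Fin.last n) (depth n) q = -1 := by
  rw [pderiv_depth hq, if_pos rfl]

theorem pderiv_depth_pow_last (k : ℕ) {q : SpaceTime n} (hq : q ∈ layer n) :
    pderiv (Fin.last n) (fun r => depth n r ^ (k + 1)) q = -((k + 1) * depth n q ^ k) := by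
  rw [pderiv_pow k contDiffOn_depth hq, pderiv_depth_last hq]; ring

theorem gradSq_nonneg (f : SpaceTime n → ℝ) (q : SpaceTime n) : 0 ≤ gradSq f q :=
  Finset.sum_nonneg fun _ _ => sq_nonneg _

theorem pderiv_sq_le_gradSq (f : SpaceTime n → ℝ) (j : Fin (n + 1)) (q : SpaceTime n) :
    pderiv j f q ^ 2 ≤ gradSq f q :=
  Finset.single_le_sum (f := fun k => pderiv k f q ^ 2) (fun _ _ => sq_nonneg _) (Finset.mem_univ j)

/-! ### Weighted inequalities at the lower wall -/

section Weighted

variable {Γ t : ℝ} {f : SpaceTime n → ℝ}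

/-- A Hardy inequality at the lower wall, with weight `(1 - x_d)^m`. -/
theorem hardy_lower (hΓ : 0 < Γ) (ht : 0 < t) (hf : ContDiffOn ℝ ∞ f (layer n))
    (h0 : ∀ q ∈ lowerWall n, f q = 0) (m : ℕ) :
    cellIntegral Γ t (fun q => (m + 1) * depth n q ^ m * f q ^ 2) ≤
      4 / (m + 1) *
        cellIntegral Γ t (fun q => depth n q ^ (m + 2) * pderiv (Fin.last n) f q ^ 2) := by
  -- There is no boundary term: `f` vanishes below and the weight above. Completing the square with
  -- `f - 2 / (m + 1) * d * ∂_d f` then gives the inequality.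
  have hdiv : cellIntegral Γ t
      (pderiv (Fin.last n) (fun q => depth n q ^ (m + 1) * f q ^ 2)) = 0 := by
    refine cellIntegral_pderiv_last hΓ ht (by fun_prop) (fun q hq => ?_) fun q hq => ?_
    · simp [h0 q hq]
    · simp [depth_upper hq]
  have hpt : ∀ q ∈ layer n, (m + 1) * depth n q ^ m * f q ^ 2 ≤
      4 / (m + 1) * (depth n q ^ (m + 2) * pderiv (Fin.last n) f q ^ 2) -
        2 * pderiv (Fin.last n) (fun q => depth n q ^ (m + 1) * f q ^ 2) q := by
    intro q hq
    rw [pderiv_mul (by fun_prop) (by fun_prop) hq, pderiv_depth_pow_last m hq,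
      pderiv_pow 1 hf hq]
    set a := f q
    set b := pderiv (Fin.last n) f q
    have hD := (depth_mem hq).1
    set d := depth n q
    have h1 : 0 ≤ (m + 1) * d ^ m * (a - 2 / (m + 1) * d * b) ^ 2 := by positivity
    have e : (m + 1) * d ^ m * (a - 2 / (m + 1) * d * b) ^ 2 =
        (m + 1) * d ^ m * a ^ 2 - 4 * d ^ (m + 1) * a * b +
          4 / (m + 1) * (d ^ (m + 2) * b ^ 2) := by
      field_simp; ring
    push_cast
    linarith
  have h := cellIntegral_mono (Γ := Γ) ht (by fun_prop) (by fun_prop) hpt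
  rw [cellIntegral_sub ht (by fun_prop) (by fun_prop), cellIntegral_const_mul,
    cellIntegral_const_mul, hdiv] at h
  linarith

/-- A trace-type inequality: the weighted integral near the lower wall is controlled by an
interpolation between the function and its vertical derivative. -/
theorem weighted_sq_le (hΓ : 0 < Γ) (ht : 0 < t) (hf : ContDiffOn ℝ ∞ f (layer n)) (k : ℕ)
    {μ : ℝ} (hμ : 1 ≤ μ) :
    (k + 1) * cellIntegral Γ t (fun q => depth n q ^ k * f q ^ 2) ≤
      2 * μ * cellIntegral Γ t (fun q => f q ^ 2) +
        μ⁻¹ * cellIntegral Γ t (fun q => pderiv (Fin.last n) f q ^ 2) := by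
  have hμ0 : 0 < μ := one_pos.trans_le hμ
  -- The multiplier `d ^ (k + 1) - d` vanishes at both walls, so `f` needs no boundary condition;
  -- its vertical derivative is `1 - (k + 1) * d ^ k`.
  have hdiv : cellIntegral Γ t
      (pderiv (Fin.last n) (fun q => (depth n q ^ (k + 1) - depth n q) * f q ^ 2)) = 0 := by
    refine cellIntegral_pderiv_last hΓ ht (by fun_prop) (fun q hq => ?_) fun q hq => ?_
    · simp [depth_lower hq]
    · simp [depth_upper hq]
  have hpt : ∀ q ∈ layer n, (k + 1) * (depth n q ^ k * f q ^ 2) ≤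
      (2 * μ * f q ^ 2 + μ⁻¹ * pderiv (Fin.last n) f q ^ 2) -
        pderiv (Fin.last n) (fun q => (depth n q ^ (k + 1) - depth n q) * f q ^ 2) q := by
    intro q hq
    rw [pderiv_mul (by fun_prop) (by fun_prop) hq, pderiv_sub (by fun_prop) (by fun_prop) hq,
      pderiv_depth_pow_last k hq, pderiv_depth_last hq, pderiv_pow 1 hf hq]
    obtain ⟨hD0, hD1⟩ := depth_mem hq
    set a := f q
    set b := pderiv (Fin.last n) f q
    set d := depth n q
    have hk : (d ^ (k + 1) - d) ^ 2 ≤ 1 := by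
      have h1 : d ^ (k + 1) ≤ 1 := pow_le_one₀ hD0 hD1
      have h2 : 0 ≤ d ^ (k + 1) := by positivity
      rw [sq_le_one_iff_abs_le_one, abs_le]; constructor <;> linarith
    have h1 : 0 ≤ μ⁻¹ * (μ * (d ^ (k + 1) - d) * a - b) ^ 2 := by positivity
    have e : μ⁻¹ * (μ * (d ^ (k + 1) - d) * a - b) ^ 2 =
        μ * a ^ 2 * (d ^ (k + 1) - d) ^ 2 - 2 * (d ^ (k + 1) - d) * a * b + μ⁻¹ * b ^ 2 := by
      field_simp; ring
    have h2 : μ * a ^ 2 * (d ^ (k + 1) - d) ^ 2 ≤ μ * a ^ 2 * 1 := by gcongr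
    -- The `1` in that derivative leaves a bare `f ^ 2`, absorbed using `1 ≤ μ`; hence the factor `2
    -- * μ`.
    have h3 : 1 * a ^ 2 ≤ μ * a ^ 2 := by gcongr
    push_cast
    linarith
  have h := cellIntegral_mono (Γ := Γ) ht (by fun_prop) (by fun_prop) hpt
  rw [cellIntegral_sub ht (by fun_prop) (by fun_prop),
    cellIntegral_add ht (by fun_prop) (by fun_prop), cellIntegral_const_mul,
    cellIntegral_const_mul, cellIntegral_const_mul, hdiv] at h
  linarith

theorem cellIntegral_depth_pow (hΓ : 0 < Γ) (ht : 0 < t) (k : ℕ) :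
    (k + 1) * cellIntegral Γ t (fun q : SpaceTime n => depth n q ^ k) = Γ ^ n := by
  have hdiv : cellIntegral Γ t
      (pderiv (Fin.last n) (fun q => depth n q ^ (k + 1) - depth n q)) = 0 := by
    refine cellIntegral_pderiv_last hΓ ht (by fun_prop) (fun q hq => ?_) fun q hq => ?_
    · simp [depth_lower hq]
    · simp [depth_upper hq]
  have hpt : ∀ q ∈ layer n, (k + 1) * depth n q ^ k =
      1 - pderiv (Fin.last n) (fun q => depth n q ^ (k + 1) - depth n q) q := by
    intro q hq
    rw [pderiv_sub (by fun_prop) (by fun_prop) hq, pderiv_depth_pow_last k hq,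
      pderiv_depth_last hq]
    ring
  have h := cellIntegral_congr (Γ := Γ) ht hpt
  rwa [cellIntegral_sub ht (by fun_prop) (by fun_prop), cellIntegral_const_mul, hdiv,
    cellIntegral_const hΓ, mul_one, sub_zero] at h

end Weighted

/-! ### Integral identities for the temperature -/

section Solution

variable {Γ Ls Ra t : ℝ} {u : SpaceTime n → Fin (n + 1) → ℝ} {p T : SpaceTime n → ℝ}

/-- The vertical heat flux. -/
noncomputable def heatFlux (u : SpaceTime n → Fin (n + 1) → ℝ) (T : SpaceTime n → ℝ) :
    SpaceTime n → ℝ := fun q => u q (Fin.last n) * T q - pderiv (Fin.last n) T q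

theorem contDiffOn_heatFlux (h : IsSolution n Γ Ls Ra u p T) :
    ContDiffOn ℝ ∞ (heatFlux u T) (layer n) := by
  have hu := contDiffOn_pi.1 h.smooth_u (Fin.last n)
  have hT := h.smooth_T
  unfold heatFlux; fun_prop

/-- `T - d` vanishes at both walls, so the conductive part `-∂_d T` has mean exactly `1`. -/
theorem cellIntegral_heatFlux (h : IsSolution n Γ Ls Ra u p T) (hΓ : 0 < Γ) (ht : 0 < t) :
    cellIntegral Γ t (heatFlux u T) =
      cellIntegral Γ t (fun q => T q * u q (Fin.last n)) + Γ ^ n := by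
  have hu := contDiffOn_pi.1 h.smooth_u (Fin.last n)
  have hT := h.smooth_T
  have hdiv : cellIntegral Γ t (pderiv (Fin.last n) (fun q => T q - depth n q)) = 0 := by
    refine cellIntegral_pderiv_last hΓ ht (by fun_prop) (fun q hq => ?_) fun q hq => ?_
    · simp [depth_lower hq, h.hot_lower q hq]
    · simp [depth_upper hq, h.cold_upper q hq]
  have hpt : ∀ q ∈ layer n, heatFlux u T q =
      (T q * u q (Fin.last n) + 1) - pderiv (Fin.last n) (fun q => T q - depth n q) q := by
    intro q hq
    rw [pderiv_sub hT (by fun_prop) hq, pderiv_depth_last hq, heatFlux]; ring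
  rw [cellIntegral_congr ht hpt, cellIntegral_sub ht (by fun_prop) (by fun_prop), hdiv,
    cellIntegral_add ht (by fun_prop) (by fun_prop), cellIntegral_const hΓ]
  ring

/-- Testing the heat equation with `T - (1 - x_d)`. -/
theorem cellIntegral_tderiv_energy (h : IsSolution n Γ Ls Ra u p T) (hΓ : 0 < Γ) (ht : 0 < t) :
    cellIntegral Γ t (tderiv (fun q => 1 / 2 * (T q * T q) - depth n q * T q)) =
      cellIntegral Γ t (heatFlux u T) - cellIntegral Γ t (gradSq T) := by
  have hu := contDiffOn_pi.1 h.smooth_u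
  have hT := h.smooth_T
  have hF := contDiffOn_heatFlux h
  have hperT := h.periodic_T
  -- `(T - d) u · ∇T = ∇ · (u (T² / 2 - d T)) - u_d T`: the gradient of `d` produces the convective
  -- flux here and the conductive flux in the diffusion term.
  have hdiv : cellIntegral Γ t (fun q => ∑ j, pderiv j (fun r => (T r - depth n r) * pderiv j T r -
      u r j * (1 / 2 * (T r * T r) - depth n r * T r)) q) = 0 := by
    refine cellIntegral_divergence hΓ ht (fun j => by fun_prop) (fun i q hq k => ?_)
      (fun q hq => ?_) fun q hq => ?_
    · simp only [hperT q hq k, horizontallyPeriodic_depth q hq k,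
        horizontallyPeriodic_pderiv hT hperT _ q hq k, h.periodic_u q hq k]
    · simp [h.hot_lower q hq, depth_lower hq, h.no_flux_lower q hq]
    · simp [h.cold_upper q hq, depth_upper hq, h.no_flux_upper q hq]
  have hpt : ∀ q ∈ layer n, tderiv (fun q => 1 / 2 * (T q * T q) - depth n q * T q) q =
      (heatFlux u T q - gradSq T q) + ∑ j, pderiv j (fun r => (T r - depth n r) * pderiv j T r -
      u r j * (1 / 2 * (T r * T r) - depth n r * T r)) q := by
    intro q hq
    have h1 : tderiv (fun q => 1 / 2 * (T q * T q) - depth n q * T q) q =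
        (T q - depth n q) * (laplacian T q - ∑ j, u q j * pderiv j T q) := by
      have h2 : tderiv (fun _ : SpaceTime n => (1 / 2 : ℝ)) q = 0 := by
        simp [tderiv]
      rw [tderiv_sub (by fun_prop) (by fun_prop) hq, tderiv_mul (by fun_prop) (by fun_prop) hq,
        tderiv_mul hT hT hq, tderiv_mul contDiffOn_depth hT hq, tderiv_depth hq, h2, ← h.heat q hq]
      ring
    have h3 : ∀ j, pderiv j (fun r => (T r - depth n r) * pderiv j T r -
        u r j * (1 / 2 * (T r * T r) - depth n r * T r)) q =
        (T q - depth n q) * pderiv j (pderiv j T) q + pderiv j T q ^ 2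
          - (T q - depth n q) * (u q j * pderiv j T q)
          - (1 / 2 * (T q * T q) - depth n q * T q) * pderiv j (fun r => u r j) q
          + (if j = Fin.last n then pderiv j T q - T q * u q j else 0) := by
      intro j
      rw [pderiv_sub (by fun_prop) (by fun_prop) hq, pderiv_mul (by fun_prop) (by fun_prop) hq,
        pderiv_mul (hu j) (by fun_prop) hq, pderiv_sub hT (by fun_prop) hq,
        pderiv_sub (by fun_prop) (by fun_prop) hq, pderiv_const_mul _ (by fun_prop) hq,
        pderiv_mul hT hT hq, pderiv_mul contDiffOn_depth hT hq, pderiv_depth hq]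
      split_ifs <;> ring
    simp only [h1, h3, Finset.sum_add_distrib, Finset.sum_sub_distrib, ← Finset.mul_sum,
      h.incompressible q hq, Finset.sum_ite_eq', Finset.mem_univ, if_true, laplacian, gradSq,
      heatFlux]
    ring
  rw [cellIntegral_congr ht hpt, cellIntegral_add ht (by fun_prop) (by fun_prop), hdiv, add_zero,
    cellIntegral_sub ht hF (by fun_prop)]

/-- Testing the heat equation with a function of `x_d` vanishing at the walls. -/
theorem cellIntegral_tderiv_weight (h : IsSolution n Γ Ls Ra u p T) (hΓ : 0 < Γ) (ht : 0 < t)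
    (m : ℕ) :
    cellIntegral Γ t (tderiv (fun q => (depth n q ^ (m + 1) - depth n q) * T q)) =
      cellIntegral Γ t (heatFlux u T) -
        cellIntegral Γ t (fun q => (m + 1) * depth n q ^ m * heatFlux u T q) := by
  have hu := contDiffOn_pi.1 h.smooth_u
  have hT := h.smooth_T
  have hF := contDiffOn_heatFlux h
  have hperT := h.periodic_T
  -- The weight vanishes at both walls. Its derivative `1 - (m + 1) * d ^ m` compares the uniform
  -- average of the flux with the average concentrated near the lower wall.
  have hdiv : cellIntegral Γ t (fun q => ∑ j, pderiv j (fun r =>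
      (depth n r ^ (m + 1) - depth n r) * (pderiv j T r - u r j * T r)) q) = 0 := by
    refine cellIntegral_divergence hΓ ht (fun j => by fun_prop) (fun i q hq k => ?_)
      (fun q hq => ?_) fun q hq => ?_
    · simp only [hperT q hq k, horizontallyPeriodic_depth q hq k,
        horizontallyPeriodic_pderiv hT hperT _ q hq k, h.periodic_u q hq k]
    · simp [depth_lower hq]
    · simp [depth_upper hq]
  have hpt : ∀ q ∈ layer n, tderiv (fun q => (depth n q ^ (m + 1) - depth n q) * T q) q =
      (heatFlux u T q - (m + 1) * depth n q ^ m * heatFlux u T q) + ∑ j, pderiv j (fun r =>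
      (depth n r ^ (m + 1) - depth n r) * (pderiv j T r - u r j * T r)) q := by
    intro q hq
    have h1 : tderiv (fun q => (depth n q ^ (m + 1) - depth n q) * T q) q =
        (depth n q ^ (m + 1) - depth n q) * (laplacian T q - ∑ j, u q j * pderiv j T q) := by
      have h2 : tderiv (fun q => depth n q ^ (m + 1) - depth n q) q = 0 := by
        have h4 := (((hasFDerivWithinAt_depth q).pow (m + 1)).sub (hasFDerivWithinAt_depth q))
        refine (congrArg (fun L => L (1, 0)) (fderivWithin_eq_of_hasFDerivWithinAt hq h4)).trans ?_
        simp
      rw [tderiv_mul (by fun_prop) hT hq, h2, ← h.heat q hq]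
      ring
    have h3 : ∀ j, pderiv j (fun r =>
        (depth n r ^ (m + 1) - depth n r) * (pderiv j T r - u r j * T r)) q =
        (depth n q ^ (m + 1) - depth n q) * pderiv j (pderiv j T) q
          - (depth n q ^ (m + 1) - depth n q) * (u q j * pderiv j T q)
          - (depth n q ^ (m + 1) - depth n q) * T q * pderiv j (fun r => u r j) q
          + (if j = Fin.last n then
            (1 - (m + 1) * depth n q ^ m) * (pderiv j T q - u q j * T q) else 0) := by
      intro j
      rw [pderiv_mul (by fun_prop) (by fun_prop) hq,
        pderiv_sub (by fun_prop) (by fun_prop) hq, pderiv_mul (hu j) hT hq,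
        pderiv_sub (by fun_prop) (by fun_prop) hq, pderiv_pow m contDiffOn_depth hq,
        pderiv_depth hq]
      split_ifs <;> ring
    simp only [h1, h3, Finset.sum_add_distrib, Finset.sum_sub_distrib, ← Finset.mul_sum,
      h.incompressible q hq, Finset.sum_ite_eq', Finset.mem_univ, if_true, laplacian,
      heatFlux]
    ring
  rw [cellIntegral_congr ht hpt, cellIntegral_add ht (by fun_prop) (by fun_prop), hdiv, add_zero,
    cellIntegral_sub ht hF (by fun_prop)]

/-- The vertical velocity has mean zero on horizontal slices, in weighted form. -/
theorem cellIntegral_depth_pow_mul_velocity (h : IsSolution n Γ Ls Ra u p T) (hΓ : 0 < Γ)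
    (ht : 0 < t) (m : ℕ) :
    cellIntegral Γ t (fun q => (m + 1) * depth n q ^ m * u q (Fin.last n)) = 0 := by
  have hu := contDiffOn_pi.1 h.smooth_u
  have hdiv : cellIntegral Γ t (fun q => ∑ j, pderiv j (fun r =>
      u r j * depth n r ^ (m + 1)) q) = 0 := by
    refine cellIntegral_divergence hΓ ht (fun j => by fun_prop) (fun i q hq k => ?_)
      (fun q hq => ?_) fun q hq => ?_
    · simp only [horizontallyPeriodic_depth q hq k, h.periodic_u q hq k]
    · simp [h.no_flux_lower q hq]
    · simp [h.no_flux_upper q hq]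
  have hpt : ∀ q ∈ layer n, (m + 1) * depth n q ^ m * u q (Fin.last n) =
      (-1) * ∑ j, pderiv j (fun r => u r j * depth n r ^ (m + 1)) q := by
    intro q hq
    have h3 : ∀ j, pderiv j (fun r => u r j * depth n r ^ (m + 1)) q =
        depth n q ^ (m + 1) * pderiv j (fun r => u r j) q +
          if j = Fin.last n then -(u q j * ((m + 1) * depth n q ^ m)) else 0 := by
      intro j
      rw [pderiv_mul (hu j) (by fun_prop) hq, pderiv_pow m contDiffOn_depth hq, pderiv_depth hq]
      split_ifs <;> ring
    simp only [h3, Finset.sum_add_distrib, ← Finset.mul_sum,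
      h.incompressible q hq, Finset.sum_ite_eq', Finset.mem_univ, if_true]
    ring
  rw [cellIntegral_congr ht hpt, cellIntegral_const_mul, hdiv, mul_zero]

end Solution

/-! ### Boundary-layer estimate and long-time average -/

section Bounds

variable {Γ Ls Ra t : ℝ} {u : SpaceTime n → Fin (n + 1) → ℝ} {p T : SpaceTime n → ℝ}

/-- Bound on the weighted heat flux in the boundary layer at the lower wall. -/
theorem cellIntegral_weighted_heatFlux_le (h : IsSolution n Γ Ls Ra u p T) (hΓ : 0 < Γ)
    (ht : 0 < t) (m : ℕ) {μ : ℝ} (hμ : 1 ≤ μ) :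
    cellIntegral Γ t (fun q => (m + 1) * depth n q ^ m * heatFlux u T q) ≤
      4 * (m + 1) * Γ ^ n + 1 / 8 * cellIntegral Γ t (gradSq T) +
        64 / (m + 1) ^ 3 * (2 * μ * cellIntegral Γ t (fun q => ∑ j, gradSq (fun r => u r j) q) +
          μ⁻¹ * cellIntegral Γ t (fun q => pderiv (Fin.last n)
            (pderiv (Fin.last n) (fun r => u r (Fin.last n))) q ^ 2)) := by
  have hu := contDiffOn_pi.1 h.smooth_u
  have hw := hu (Fin.last n)
  have hT := h.smooth_T
  have hF := contDiffOn_heatFlux h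
  set N : ℝ := m + 1 with hN
  have hN0 : 0 < N := by positivity
  -- Young's inequality for `w * (T - 1)` and for `∂_d T`. The coefficient `N / 64` becomes `1 / 16`
  -- after Hardy's factor `4 / N`; with the other `1 / 16` this makes `1 / 8` of `∫ |∇T|²`.
  have hpt : ∀ q ∈ layer n, N * depth n q ^ m * heatFlux u T q ≤
      N * depth n q ^ m * u q (Fin.last n) + N / 64 * (N * depth n q ^ m * (T q - 1) ^ 2) +
        16 / N * (N * depth n q ^ m * u q (Fin.last n) ^ 2) + 1 / 16 * gradSq T q +
        4 * N ^ 2 * depth n q ^ (2 * m) := by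
    intro q hq
    have hD := (depth_mem hq).1
    have hgr := pderiv_sq_le_gradSq T (Fin.last n) q
    rw [heatFlux]
    set w := u q (Fin.last n)
    set b := pderiv (Fin.last n) T q
    set d := depth n q
    have h1 : 0 ≤ N * d ^ m * (N / 64 * ((T q - 1) - 32 / N * w) ^ 2) := by positivity
    have e1 : N * d ^ m * (N / 64 * ((T q - 1) - 32 / N * w) ^ 2) =
        N / 64 * (N * d ^ m * (T q - 1) ^ 2) - N * d ^ m * (w * (T q - 1)) +
          16 / N * (N * d ^ m * w ^ 2) := by
      field_simp; ring
    have h2 : 0 ≤ 1 / 16 * (b + 8 * (N * d ^ m)) ^ 2 := by positivity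
    have e2 : d ^ (2 * m) = (d ^ m) ^ 2 := by rw [mul_comm, pow_mul]
    rw [e2]
    nlinarith
  have hint := cellIntegral_mono (Γ := Γ) ht (by fun_prop) (by fun_prop) hpt
  rw [cellIntegral_add ht (by fun_prop) (by fun_prop),
    cellIntegral_add ht (by fun_prop) (by fun_prop),
    cellIntegral_add ht (by fun_prop) (by fun_prop),
    cellIntegral_add ht (by fun_prop) (by fun_prop), cellIntegral_const_mul,
    cellIntegral_const_mul, cellIntegral_const_mul, cellIntegral_const_mul,
    cellIntegral_depth_pow_mul_velocity h hΓ ht m] at hint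
  have hS := hardy_lower hΓ ht (f := fun q => T q - 1) (by fun_prop)
    (fun q hq => by simp [h.hot_lower q hq]) m
  have hW := hardy_lower hΓ ht hw h.no_flux_lower m
  have hX : cellIntegral Γ t (fun q => depth n q ^ (m + 2) *
      pderiv (Fin.last n) (fun q => T q - 1) q ^ 2) ≤ cellIntegral Γ t (gradSq T) := by
    refine cellIntegral_mono ht (by fun_prop) (by fun_prop) fun q hq => ?_
    rw [pderiv_sub hT contDiffOn_const hq, pderiv_const 1 hq, sub_zero]
    refine le_trans ?_ (pderiv_sq_le_gradSq T (Fin.last n) q)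
    exact mul_le_of_le_one_left (sq_nonneg _) (pow_le_one₀ (depth_mem hq).1 (depth_mem hq).2)
  -- The third factor `1 / N`, after those of Young and Hardy: `∂_d w` need not vanish at the wall,
  -- so Hardy's inequality cannot be iterated.
  have hH := weighted_sq_le hΓ ht (contDiffOn_pderiv (Fin.last n) hw) (m + 2) hμ
  have hE : cellIntegral Γ t (fun q => pderiv (Fin.last n) (fun r => u r (Fin.last n)) q ^ 2) ≤
      cellIntegral Γ t (fun q => ∑ j, gradSq (fun r => u r j) q) := by
    refine cellIntegral_mono ht (by fun_prop) (by fun_prop) fun q hq => ?_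
    exact (pderiv_sq_le_gradSq _ (Fin.last n) q).trans
      (Finset.single_le_sum (f := fun j => gradSq (fun r => u r j) q)
        (fun j _ => gradSq_nonneg _ _) (Finset.mem_univ _))
  have hP := cellIntegral_depth_pow (n := n) hΓ ht (2 * m)
  set P := cellIntegral Γ t (fun q : SpaceTime n => depth n q ^ (2 * m))
  set X := cellIntegral Γ t (gradSq T)
  set E := cellIntegral Γ t (fun q => ∑ j, gradSq (fun r => u r j) q)
  set H := cellIntegral Γ t (fun q => pderiv (Fin.last n) (fun r => u r (Fin.last n)) q ^ 2)
  set Z := cellIntegral Γ t (fun q => pderiv (Fin.last n)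
            (pderiv (Fin.last n) (fun r => u r (Fin.last n))) q ^ 2)
  set A := cellIntegral Γ t (fun q => depth n q ^ (m + 2) *
    pderiv (Fin.last n) (fun r => u r (Fin.last n)) q ^ 2)
  have hA0 : 0 ≤ A := cellIntegral_nonneg ht fun q hq =>
    mul_nonneg (pow_nonneg (depth_mem hq).1 _) (sq_nonneg _)
  have hP0 : 0 ≤ P := cellIntegral_nonneg ht fun q hq => pow_nonneg (depth_mem hq).1 _
  have hA : N * A ≤ 2 * μ * E + μ⁻¹ * Z := by
    have h1 : N * A ≤ (((m + 2 : ℕ) : ℝ) + 1) * A := by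
      gcongr; push_cast; linarith
    have h2 : 2 * μ * H ≤ 2 * μ * E := by gcongr
    linarith
  have hPP : 4 * N ^ 2 * P ≤ 4 * N * Γ ^ n := by
    have h1 : N * P ≤ Γ ^ n := by
      rw [← hP]; gcongr; push_cast; linarith [(Nat.cast_nonneg m : (0 : ℝ) ≤ m)]
    have h2 : 4 * N * (N * P) ≤ 4 * N * Γ ^ n := by gcongr
    linarith
  have hSX := mul_le_mul_of_nonneg_left (hS.trans (mul_le_mul_of_nonneg_left hX (by positivity)))
    (by positivity : 0 ≤ N / 64)
  have hSX' : N / 64 * (4 / N * X) = 1 / 16 * X := by field_simp; ring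
  have hWA := mul_le_mul_of_nonneg_left hW (by positivity : 0 ≤ 16 / N)
  have hWA' : 16 / N * (4 / N * A) = 64 / N ^ 3 * (N * A) := by field_simp; ring
  have hAA := mul_le_mul_of_nonneg_left hA (by positivity : 0 ≤ 64 / N ^ 3)
  linarith

/-- The flux inequality at a fixed time, up to the time derivative of a functional that is bounded
above. -/
theorem cellIntegral_heatFlux_le (h : IsSolution n Γ Ls Ra u p T) (hΓ : 0 < Γ) (hLs : 0 < Ls)
    {r : ℝ} (hr : 1 ≤ r) (hrRa : r ^ 4 = Ra) (ht : 0 < t) (m : ℕ)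
    (hm : 512 * (n + 2) * r ^ 5 ≤ ((m : ℝ) + 1) ^ 3) :
    5 / 8 * cellIntegral Γ t (heatFlux u T) ≤ 4 * (m + 1) * Γ ^ n +
      cellIntegral Γ t (tderiv fun q => (depth n q ^ (m + 1) - depth n q) * T q -
        1 / 4 * (1 / 2 * (T q * T q) - depth n q * T q)) := by
  have hu := contDiffOn_pi.1 h.smooth_u
  have hT := h.smooth_T
  have hr0 : 0 < r := one_pos.trans_le hr
  have hRa : 0 < Ra := by rw [← hrRa]; positivity
  have hsplit : cellIntegral Γ t (tderiv fun q => (depth n q ^ (m + 1) - depth n q) * T q -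
        1 / 4 * (1 / 2 * (T q * T q) - depth n q * T q)) =
      cellIntegral Γ t (tderiv fun q => (depth n q ^ (m + 1) - depth n q) * T q) -
        1 / 4 * cellIntegral Γ t (tderiv fun q => 1 / 2 * (T q * T q) - depth n q * T q) := by
    rw [← cellIntegral_const_mul, ← cellIntegral_sub ht (by fun_prop) (by fun_prop)]
    refine cellIntegral_congr ht fun q hq => ?_
    rw [tderiv_sub (by fun_prop) (by fun_prop) hq,
      tderiv_mul contDiffOn_const (by fun_prop) hq]
    simp [tderiv]
  rw [hsplit, cellIntegral_tderiv_energy h hΓ ht, cellIntegral_tderiv_weight h hΓ ht m]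
  have hst := h.isStokesSolution
  have hen := hst.energy hΓ hLs ht
  -- With `r = Ra ^ (1/4)`, the choices `κ = r ^ 2` here and `μ = r` below give `E`, `X` and `Φ` the
  -- common order `r ^ 5`.
  have hZ := hst.integral_pderiv_last_last_sq_le hΓ hLs hRa ht (κ := r ^ 2) (by positivity)
  have hfl := cellIntegral_heatFlux h hΓ ht
  have hbl := cellIntegral_weighted_heatFlux_le h hΓ ht m hr
  have hX0 : 0 ≤ cellIntegral Γ t (gradSq T) := cellIntegral_nonneg ht fun q _ => gradSq_nonneg _ _
  have hE0 : 0 ≤ cellIntegral Γ t (fun q => ∑ j, gradSq (fun r => u r j) q) :=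
    cellIntegral_nonneg ht fun q _ => Finset.sum_nonneg fun j _ => gradSq_nonneg _ _
  set X := cellIntegral Γ t (gradSq T)
  set E := cellIntegral Γ t (fun q => ∑ j, gradSq (fun r => u r j) q)
  set Z := cellIntegral Γ t (fun q => pderiv (Fin.last n)
            (pderiv (Fin.last n) (fun r => u r (Fin.last n))) q ^ 2)
  set W := cellIntegral Γ t (fun q => T q * u q (Fin.last n))
  set Φ := cellIntegral Γ t (heatFlux u T)
  have hΓn : 0 < Γ ^ n := by positivity
  have hEΦ : E ≤ Ra * Φ := hen.trans (by gcongr; linarith)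
  have hΦ0 : 0 ≤ Φ := nonneg_of_mul_nonneg_right (hE0.trans hEΦ) hRa
  have hZ' : r⁻¹ * Z ≤ n / 2 * r ^ 5 * (X + Φ) := by
    calc r⁻¹ * Z ≤ r⁻¹ * (n * Ra / 2 * (r ^ 2 * X + (r ^ 2)⁻¹ * (Ra * Φ))) := by
          gcongr
          exact hZ.trans (by gcongr)
      _ = n / 2 * r ^ 5 * (X + Φ) := by rw [← hrRa]; field_simp
  have hE' : 2 * r * E ≤ 2 * r ^ 5 * Φ := by
    calc 2 * r * E ≤ 2 * r * (Ra * Φ) := by gcongr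
      _ = 2 * r ^ 5 * Φ := by rw [← hrRa]; ring
  have hbr : 2 * r * E + r⁻¹ * Z ≤ (n + 2) * r ^ 5 * (X + Φ) := by
    have hn0 : (0 : ℝ) ≤ n := Nat.cast_nonneg n
    have h1 : 0 ≤ r ^ 5 * X := by positivity
    have h2 : 0 ≤ n * (r ^ 5 * (X + Φ)) := by positivity
    linarith
  have hfin : 64 / ((m : ℝ) + 1) ^ 3 * (2 * r * E + r⁻¹ * Z) ≤ 1 / 8 * (X + Φ) := by
    have hN : 0 < ((m : ℝ) + 1) ^ 3 := by positivity
    rw [div_mul_eq_mul_div, div_le_iff₀ hN]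
    have h1 := mul_le_mul_of_nonneg_right hm (add_nonneg hX0 hΦ0)
    linarith
  -- The gradient appears with `1 / 8 + 1 / 8` and is exchanged for `Φ` by the energy identity; `5 /
  -- 8 = 1 - 1 / 4 - 1 / 8`.
  linarith

/-- The spatially averaged heat flux stays bounded near the initial time. -/
theorem cellIntegral_heatFlux_mem_Icc (h : IsSolution n Γ Ls Ra u p T) (hΓ : 0 < Γ) (hLs : 0 < Ls)
    (hRa : 0 < Ra) {M : ℝ} (ht : 0 < t) (hM : ∀ x ∈ cell n Γ, |T (t, x)| ≤ M) :
    cellIntegral Γ t (heatFlux u T) ∈ Icc 0 (4 * Ra * (Γ ^ n * M ^ 2) + Γ ^ n) := by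
  have hw := contDiffOn_pi.1 h.smooth_u (Fin.last n)
  have hu := contDiffOn_pi.1 h.smooth_u
  have hT := h.smooth_T
  have hen := h.isStokesSolution.energy hΓ hLs ht
  have hW := hardy_lower hΓ ht hw h.no_flux_lower 0
  have hE : cellIntegral Γ t (fun q => depth n q ^ (0 + 2) *
      pderiv (Fin.last n) (fun r => u r (Fin.last n)) q ^ 2) ≤
      cellIntegral Γ t (fun q => ∑ j, gradSq (fun r => u r j) q) := by
    refine cellIntegral_mono ht (by fun_prop) (by fun_prop) fun q hq => ?_
    refine (mul_le_of_le_one_left (sq_nonneg _)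
      (pow_le_one₀ (depth_mem hq).1 (depth_mem hq).2)).trans ?_
    exact (pderiv_sq_le_gradSq _ (Fin.last n) q).trans
      (Finset.single_le_sum (f := fun j => gradSq (fun r => u r j) q)
        (fun j _ => gradSq_nonneg _ _) (Finset.mem_univ _))
  have hE0 : 0 ≤ cellIntegral Γ t (fun q => ∑ j, gradSq (fun r => u r j) q) :=
    cellIntegral_nonneg ht fun q _ => Finset.sum_nonneg fun j _ => gradSq_nonneg _ _
  have hTM : cellIntegral Γ t (fun q => T q ^ 2) ≤ Γ ^ n * M ^ 2 := by
    rw [← cellIntegral_const hΓ (n := n) (t := t)]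
    refine setIntegral_mono_on (integrableOn_slice (hT.pow 2) ht)
      (integrableOn_slice contDiffOn_const ht) measurableSet_cell fun x hx => ?_
    exact sq_le_sq.2 ((hM x hx).trans (le_abs_self M))
  -- The coefficient `1 / (8 * Ra)` is such that Hardy (factor `4`) and the energy inequality
  -- (factor `Ra`) return half of `∫ T u_d`, which is absorbed.
  have hpt : ∀ q ∈ layer n, T q * u q (Fin.last n) ≤ 2 * Ra * T q ^ 2 +
      1 / (8 * Ra) * (((0 : ℕ) + 1) * depth n q ^ 0 * u q (Fin.last n) ^ 2) := by
    intro q _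
    set w := u q (Fin.last n)
    have h1 : 0 ≤ 2 * Ra * (T q - 1 / (4 * Ra) * w) ^ 2 := by positivity
    have e1 : 2 * Ra * (T q - 1 / (4 * Ra) * w) ^ 2 =
        2 * Ra * T q ^ 2 - T q * w + 1 / (8 * Ra) * w ^ 2 := by field_simp; ring
    simp only [Nat.cast_zero, zero_add, pow_zero, one_mul]
    linarith
  have hint := cellIntegral_mono (Γ := Γ) ht (by fun_prop) (by fun_prop) hpt
  rw [cellIntegral_add ht (by fun_prop) (by fun_prop), cellIntegral_const_mul,
    cellIntegral_const_mul] at hint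
  rw [cellIntegral_heatFlux h hΓ ht]
  have hΓn : 0 < Γ ^ n := by positivity
  simp only [Nat.cast_zero, zero_add, div_one] at hW hint hE
  set E := cellIntegral Γ t (fun q => ∑ j, gradSq (fun r => u r j) q)
  set W := cellIntegral Γ t (fun q => T q * u q (Fin.last n))
  have hW0 : 0 ≤ W := nonneg_of_mul_nonneg_right (hE0.trans hen) hRa
  have h1 := mul_le_mul_of_nonneg_left (hW.trans (mul_le_mul_of_nonneg_left (hE.trans hen)
    (by norm_num : (0 : ℝ) ≤ 4))) (by positivity : 0 ≤ 1 / (8 * Ra))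
  have e1 : 1 / (8 * Ra) * (4 * (Ra * W)) = 1 / 2 * W := by field_simp; ring
  have h2 := mul_le_mul_of_nonneg_left hTM (by positivity : 0 ≤ 2 * Ra)
  exact ⟨by linarith, by linarith⟩

/-- Continuity of `T` up to `t = 0` enters here: by compactness `T` is bounded on the cell for times
in `[0, 1]`, and this bounds the averaged flux although nothing is assumed of `u` at the initial
time. -/
theorem intervalIntegrable_heatFlux_zero_one (h : IsSolution n Γ Ls Ra u p T) (hΓ : 0 < Γ)
    (hLs : 0 < Ls) (hRa : 0 < Ra) :
    IntervalIntegrable (fun t => cellIntegral Γ t (heatFlux u T)) volume 0 1 := by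
  have hsub : Icc (0 : ℝ) 1 ×ˢ cell n Γ ⊆ closedLayer n := fun q hq =>
    ⟨hq.1.1, by simpa using hq.2.1 (Fin.last n), by simpa using hq.2.2 (Fin.last n)⟩
  obtain ⟨M, hM⟩ := (isCompact_Icc.prod (isCompact_cell (n := n) (Γ := Γ))).bddAbove_image
    (h.continuous_T.norm.mono hsub)
  rw [intervalIntegrable_iff_integrableOn_Ioc_of_le zero_le_one]
  refine IntegrableOn.of_bound (by simp)
    (((continuousOn_cellIntegral (contDiffOn_heatFlux h).continuousOn).mono
      Ioc_subset_Ioi_self).aestronglyMeasurable measurableSet_Ioc)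
    (4 * Ra * (Γ ^ n * M ^ 2) + Γ ^ n) ?_
  filter_upwards [ae_restrict_mem measurableSet_Ioc] with t ht
  have := cellIntegral_heatFlux_mem_Icc h hΓ hLs hRa (M := M) ht.1 fun x hx =>
    hM (mem_image_of_mem _ (mk_mem_prod ⟨ht.1.le, ht.2⟩ hx))
  rw [Real.norm_eq_abs, abs_of_nonneg this.1]
  exact this.2

/-- The time-integrated flux bound. -/
theorem exists_integral_heatFlux_le (h : IsSolution n Γ Ls Ra u p T) (hΓ : 0 < Γ) (hLs : 0 < Ls)
    {r : ℝ} (hr : 1 ≤ r) (hrRa : r ^ 4 = Ra) (m : ℕ)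
    (hm : 512 * (n + 2) * r ^ 5 ≤ ((m : ℝ) + 1) ^ 3) :
    ∃ B : ℝ, ∀ τ : ℝ, 1 ≤ τ → ∫ t in (0 : ℝ)..τ, cellIntegral Γ t (heatFlux u T) ≤
      32 / 5 * (m + 1) * Γ ^ n * τ + B := by
  have hT := h.smooth_T
  have hRa : 0 < Ra := by rw [← hrRa]; positivity
  set ℓ : SpaceTime n → ℝ := fun q => (depth n q ^ (m + 1) - depth n q) * T q -
    1 / 4 * (1 / 2 * (T q * T q) - depth n q * T q) with hℓ
  have hℓs : ContDiffOn ℝ ∞ ℓ (layer n) := by rw [hℓ]; fun_prop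
  -- With `c = d ^ (m + 1) - 3 / 4 * d`, the functional is `c * T - T ^ 2 / 8 ≤ 2 * c ^ 2`, for
  -- every value of `T`.
  have hℓ2 : ∀ q ∈ layer n, ℓ q ≤ 2 := by
    intro q hq
    obtain ⟨hD0, hD1⟩ := depth_mem hq
    simp only [hℓ]
    set d := depth n q
    have h1 : d ^ (m + 1) ≤ 1 := pow_le_one₀ hD0 hD1
    have h2 : 0 ≤ d ^ (m + 1) := by positivity
    have h3 : (d ^ (m + 1) - 3 / 4 * d) ^ 2 ≤ 1 := by
      rw [sq_le_one_iff_abs_le_one, abs_le]; constructor <;> linarith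
    nlinarith [sq_nonneg (T q - 4 * (d ^ (m + 1) - 3 / 4 * d))]
  have hΓn : 0 < Γ ^ n := by positivity
  -- The flux on `[0, 1]`, plus the largest possible increase of `∫ ℓ` after time `1`, multiplied by
  -- `8 / 5`.
  refine ⟨(∫ t in (0 : ℝ)..1, cellIntegral Γ t (heatFlux u T)) +
    8 / 5 * (Γ ^ n * 2 - cellIntegral Γ 1 ℓ), fun τ hτ => ?_⟩
  have hsub : uIcc 1 τ ⊆ Ioi 0 := fun t ht => by
    rw [uIcc_of_le hτ] at ht; exact one_pos.trans_le ht.1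
  have hi1 : IntervalIntegrable (fun t => cellIntegral Γ t (heatFlux u T)) volume 1 τ :=
    ((continuousOn_cellIntegral (contDiffOn_heatFlux h).continuousOn).mono hsub).intervalIntegrable
  have hi2 : IntervalIntegrable (fun t => cellIntegral Γ t (tderiv ℓ)) volume 1 τ :=
    ((continuousOn_cellIntegral (contDiffOn_tderiv hℓs).continuousOn).mono hsub).intervalIntegrable
  rw [← intervalIntegral.integral_add_adjacent_intervals
    (intervalIntegrable_heatFlux_zero_one h hΓ hLs hRa) hi1]
  have hle : ∫ t in (1 : ℝ)..τ, cellIntegral Γ t (heatFlux u T) ≤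
      ∫ t in (1 : ℝ)..τ, (32 / 5 * (m + 1) * Γ ^ n + 8 / 5 * cellIntegral Γ t (tderiv ℓ)) := by
    refine intervalIntegral.integral_mono_on hτ hi1
      (intervalIntegrable_const.add (hi2.const_mul _)) fun t ht => ?_
    have := cellIntegral_heatFlux_le h hΓ hLs hr hrRa (one_pos.trans_le ht.1) m hm
    linarith
  rw [intervalIntegral.integral_add intervalIntegrable_const (hi2.const_mul _),
    intervalIntegral.integral_const, intervalIntegral.integral_const_mul,
    integral_cellIntegral_tderiv hℓs one_pos hτ, smul_eq_mul] at hle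
  have hL : cellIntegral Γ τ ℓ ≤ Γ ^ n * 2 := by
    rw [← cellIntegral_const hΓ (n := n) (t := τ)]
    exact cellIntegral_mono (one_pos.trans_le hτ) hℓs contDiffOn_const hℓ2
  have hc : 0 ≤ 32 / 5 * ((m : ℝ) + 1) * Γ ^ n := by positivity
  linarith

/-- The Nusselt number is bounded by the inverse width of an admissible boundary layer. -/
theorem nusselt_le (h : IsSolution n Γ Ls Ra u p T) (hΓ : 0 < Γ) (hLs : 0 < Ls)
    {r : ℝ} (hr : 1 ≤ r) (hrRa : r ^ 4 = Ra) (m : ℕ)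
    (hm : 512 * (n + 2) * r ^ 5 ≤ ((m : ℝ) + 1) ^ 3) :
    nusselt Γ u T ≤ ((7 * ((m : ℝ) + 1) : ℝ) : EReal) := by
  obtain ⟨B, hB⟩ := exists_integral_heatFlux_le h hΓ hLs hr hrRa m hm
  have hΓn : 0 < Γ ^ n := by positivity
  refine Filter.limsup_le_of_le (h := ?_)
  -- For such `τ` the constant `B` is at most `τ * Γ ^ n / 2`, which fits in the gap `7 - 32 / 5 = 3
  -- / 5`.
  filter_upwards [Filter.eventually_ge_atTop 1, Filter.eventually_ge_atTop (2 * B / Γ ^ n)]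
    with τ h1 h2
  rw [EReal.coe_le_coe_iff, finiteTimeAverage, intervalIntegral.integral_const_mul]
  have hτ : 0 < τ := one_pos.trans_le h1
  have h3 := hB τ h1
  rw [div_le_iff₀ hΓn] at h2
  have h4 : ∫ t in (0 : ℝ)..τ, cellIntegral Γ t (heatFlux u T) ≤ 7 * (m + 1) * (Γ ^ n * τ) := by
    have h5 : 1 * (τ * Γ ^ n) ≤ (m + 1) * (τ * Γ ^ n) := by
      gcongr; linarith [(Nat.cast_nonneg m : (0 : ℝ) ≤ m)]
    have h6 : 0 ≤ τ * Γ ^ n := by positivity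
    linarith
  calc _ = (∫ t in (0 : ℝ)..τ, cellIntegral Γ t (heatFlux u T)) / (Γ ^ n * τ) := by
        simp only [cellIntegral, heatFlux]; field_simp
    _ ≤ _ := by rwa [div_le_iff₀ (by positivity)]

end Bounds

end RayleighBenard

/-! ### Choice of the boundary-layer width -/

theorem mainTheorem3 (n : ℕ) (hn : 1 ≤ n) (Γ : ℝ) (hΓ : 0 < Γ) :
    ∃ C : ℝ, 0 < C ∧ ∀ Ls Ra : ℝ, 0 < Ls → 1 < Ra →
      ∀ (u : RayleighBenard.SpaceTime n → Fin (n + 1) → ℝ) (p T : RayleighBenard.SpaceTime n → ℝ),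
        RayleighBenard.IsSolution n Γ Ls Ra u p T →
          RayleighBenard.nusselt Γ u T ≤ ((C * Ra ^ (5 / 12 : ℝ) : ℝ) : EReal) := by
  -- `m + 1 ≤ 8 * (n + 2) * s + 1 ≤ (8 * (n + 2) + 1) * s` for `s = Ra ^ (5/12) ≥ 1`; the `8` is the
  -- cube root of `512`.
  refine ⟨7 * (8 * (n + 2) + 1), by positivity, fun Ls Ra hLs hRa u p T h => ?_⟩
  have hRa0 : 0 < Ra := one_pos.trans hRa
  set s : ℝ := Ra ^ (5 / 12 : ℝ) with hs
  have hs1 : 1 ≤ s := Real.one_le_rpow hRa.le (by norm_num)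
  set r : ℝ := Ra ^ (1 / 4 : ℝ) with hr
  have hr4 : r ^ 4 = Ra := by
    rw [hr, ← Real.rpow_natCast, ← Real.rpow_mul hRa0.le]; norm_num
  have hrs : s ^ 3 = r ^ 5 := by
    rw [hr, hs, ← Real.rpow_natCast, ← Real.rpow_natCast, ← Real.rpow_mul hRa0.le,
      ← Real.rpow_mul hRa0.le]
    norm_num
  have hn0 : (0 : ℝ) ≤ n := Nat.cast_nonneg n
  have hlt := (Nat.lt_floor_add_one (8 * ((n : ℝ) + 2) * s)).le
  have hle := Nat.floor_le (by positivity : 0 ≤ 8 * ((n : ℝ) + 2) * s)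
  set m := ⌊8 * ((n : ℝ) + 2) * s⌋₊
  have hm : 512 * (n + 2) * r ^ 5 ≤ ((m : ℝ) + 1) ^ 3 := by
    refine le_trans ?_ (pow_le_pow_left₀ (by positivity) hlt 3)
    have h1 : (n : ℝ) + 2 ≤ (n + 2) ^ 3 := le_self_pow₀ (by linarith) (by norm_num)
    calc 512 * ((n : ℝ) + 2) * r ^ 5 ≤ 512 * (n + 2) ^ 3 * r ^ 5 := by gcongr
      _ = (8 * ((n : ℝ) + 2) * s) ^ 3 := by rw [mul_pow, mul_pow, hrs]; norm_num
  refine (RayleighBenard.nusselt_le h hΓ hLs (Real.one_le_rpow hRa.le (by norm_num)) hr4 m hm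
    ).trans (EReal.coe_le_coe_iff.2 ?_)
  linarith
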